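/- Let $1\le m\le n$ and let $M_{m,n}(\mathbb{C})\cong\mathbb{C}^{mn}$ be the space of complex $m\times n$ matrices. Let $Q_1\subseteq\{1,\dots,n\}^2$ be a reflexive and transitive relation with $|Q_1|=mn-m^2+1$, and let $$G_R=\{B\in \mathrm{GL}_n(\mathbb{C}) : B_{ij}=0\text{ whenever }(i,j)\notin Q_1\},$$ which is a group. Let $G=\mathrm{GL}_m(\mathbb{C})\times G_R$ act on $M_{m,n}(\mathbb{C})$ by $(A,B)\cdot M=AMB^{-1}$, and let $\mathfrak{g}\subseteq\mathfrak{gl}(M_{m,n}(\mathbb{C}))$ be the Lie algebra of the image of $G$ in $\mathrm{GL}(M_{m,n}(\mathbb{C}))$ (that is, of $G$ modulo the scalars $Z=\mathbb{C}^*\cdot(I_m,I_n)$ acting trivially). Then $\dim_{\mathbb{C}}\mathfrak{g}=mn$. For a basis $A_1,\dots,A_{mn}$ of $\mathfrak{g}$ let $\Delta(x)=\det\bigl(A_1x,\dots,A_{mn}x\bigr)\in\mathbb{C}[M_{m,n}]$ be the discriminant determinant of the action of $G$; it is determined up to a nonzero constant factor. A reduced divisor $D\subset\mathbb{C}^N$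 with reduced (holomorphic) defining equation $f$ is called a linear free divisor if the sheaf $\mathrm{Der}(-\log D)$ of holomorphic vector fields $\delta$ with $\delta(f)\in\mathcal{O}\cdot f$ is a locally free $\mathcal{O}$-module and its module of global sections has, over the ring of entire functions, a basis of vector fields with linear coefficients. 1. If $\Delta$ is not identically zero and the action of $G$ preserves the divisors of zeros of precisely $n$ distinct $m\times m$ minors of the generic $m\times n$ matrix, then the union $D$ of these divisors is a linear free divisor, and $D=V(\Delta)$, where $\Delta$ is a reduced equation of $D$. 2. If the action of $G$ preserves the divisors of zeros of more than $n$ distinct $m\times m$ minors, then $\Delta$ is identically zero. -/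

import Mathlib

open Matrix

/-! ### Linear free divisors in affine space -/

/-- Coordinates are indexed by a finite type `ι`, so the ambient space is `ι → ℂ`. A function is
holomorphic on an open set `U` when it is complex differentiable there.

`IsReducedEquation f D`: the entire function `f` is a (global) defining equation of the reduced
divisor `D`, that is, `D` is a proper subset of the space, `f` vanishes exactly on `D`, and over
every open set `f` generates the ideal of the holomorphic functions that vanish on `D`. -/
def IsReducedEquation {ι : Type*} [Fintype ι] (f : (ι → ℂ) → ℂ) (D : Set (ι → ℂ)) : Prop :=
  Differentiable ℂ f ∧ D ≠ Set.univ ∧ D = {x | f x = 0} ∧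
    ∀ (U : Set (ι → ℂ)) (g : (ι → ℂ) → ℂ), IsOpen U → DifferentiableOn ℂ g U →
      (∀ x ∈ U, x ∈ D → g x = 0) →
        ∃ q : (ι → ℂ) → ℂ, DifferentiableOn ℂ q U ∧ ∀ x ∈ U, g x = q x * f x

/-- `δ` is, over the open set `U`, a section of the sheaf of logarithmic vector fields along the
divisor with equation `f`: it is holomorphic on `U`, and the derivative of `f` along `δ` is a
holomorphic multiple of `f` on `U`. -/
def IsLogVectorField {ι : Type*} [Fintype ι] (f : (ι → ℂ) → ℂ) (U : Set (ι → ℂ))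
    (δ : (ι → ℂ) → (ι → ℂ)) : Prop :=
  DifferentiableOn ℂ δ U ∧
    ∃ q : (ι → ℂ) → ℂ, DifferentiableOn ℂ q U ∧ ∀ x ∈ U, fderiv ℂ f x (δ x) = q x * f x

/-- The family `δ` is, over the open set `U`, a basis of the module of logarithmic vector fields
over the ring of holomorphic functions on `U`. -/
def IsLogBasis {ι κ : Type*} [Fintype ι] [Fintype κ] (f : (ι → ℂ) → ℂ) (U : Set (ι → ℂ))
    (δ : κ → (ι → ℂ) → (ι → ℂ)) : Prop :=
  (∀ k, IsLogVectorField f U (δ k)) ∧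
  (∀ η : (ι → ℂ) → (ι → ℂ), IsLogVectorField f U η →
    ∃ h : κ → (ι → ℂ) → ℂ, (∀ k, DifferentiableOn ℂ (h k) U) ∧
      ∀ x ∈ U, η x = ∑ k, h k x • δ k x) ∧
  (∀ h : κ → (ι → ℂ) → ℂ, (∀ k, DifferentiableOn ℂ (h k) U) →
    (∀ x ∈ U, ∑ k, h k x • δ k x = 0) → ∀ k, ∀ x ∈ U, h k x = 0)

/-- The sheaf of logarithmic vector fields along the divisor with equation `f` is locally free. -/
def IsLocallyFreeLog {ι : Type*} [Fintype ι] (f : (ι → ℂ) → ℂ) : Prop :=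
  ∀ p : ι → ℂ, ∃ U : Set (ι → ℂ), IsOpen U ∧ p ∈ U ∧
    ∃ (r : ℕ) (δ : Fin r → (ι → ℂ) → (ι → ℂ)),
      ∀ V : Set (ι → ℂ), IsOpen V → V ⊆ U → IsLogBasis f V δ

/-- `D` is a linear free divisor: a reduced divisor whose sheaf of logarithmic vector fields is
locally free, and whose module of global logarithmic vector fields has a basis consisting of
linear vector fields `x ↦ B k *ᵥ x`. -/
def IsLinearFreeDivisor {ι : Type*} [Fintype ι] (D : Set (ι → ℂ)) : Prop :=
  ∃ f : (ι → ℂ) → ℂ, IsReducedEquation f D ∧ IsLocallyFreeLog f ∧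
    ∃ B : ι → Matrix ι ι ℂ, IsLogBasis f Set.univ (fun k x => B k *ᵥ x)

/-! ### Lie algebras of linear algebraic groups and the discriminant determinant -/

/-- The Lie algebra of a linear algebraic group `H ⊆ GL_ι(ℂ)`, as a space of matrices: the Zariski
tangent space at the identity, that is, all `X` such that for every polynomial `p` in the matrix
entries that vanishes on `H` the differential of `p` at the identity vanishes on `X`
(equivalently, `1 + ε X` with `ε ^ 2 = 0` satisfies all the equations of `H`). -/
def lieAlgebraOf {ι : Type*} [Fintype ι] [DecidableEq ι] (H : Subgroup (GL ι ℂ)) :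
    Submodule ℂ (Matrix ι ι ℂ) where
  carrier := {X | ∀ p : MvPolynomial (ι × ι) ℂ,
    (∀ g ∈ H, MvPolynomial.eval (fun q => (g : Matrix ι ι ℂ) q.1 q.2) p = 0) →
      ∑ q : ι × ι, MvPolynomial.eval (fun q => (1 : Matrix ι ι ℂ) q.1 q.2)
        (MvPolynomial.pderiv q p) * X q.1 q.2 = 0}
  zero_mem' := by
    intro p _
    simp
  add_mem' := by
    intro X Y hX hY p hp
    simp only [Matrix.add_apply, mul_add, Finset.sum_add_distrib, hX p hp, hY p hp, add_zero]
  smul_mem' := by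
    intro c X hX p hp
    have h := hX p hp
    simp only [Matrix.smul_apply, smul_eq_mul, mul_left_comm _ c, ← Finset.mul_sum, h, mul_zero]

/-- The discriminant determinant `Δ = det (A₁ x, …, A_N x)` of a linear algebraic group acting on
`ι → ℂ`, for a basis `A` of its Lie algebra; it is a polynomial in the coordinates `x`, and a
change of basis multiplies it by a nonzero constant. -/
noncomputable def discriminantDet {ι : Type*} [Fintype ι] [DecidableEq ι]
    {L : Submodule ℂ (Matrix ι ι ℂ)} (A : Module.Basis ι ℂ L) : MvPolynomial ι ℂ :=
  (Matrix.of fun i k : ι =>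
    ∑ j, MvPolynomial.C ((A k : Matrix ι ι ℂ) i j) * MvPolynomial.X j).det

/-! ### The group acting on the space of matrices -/

/-- For a reflexive and transitive set `Q` of arrows on the vertices `0, …, n - 1`, the group of
the invertible matrices all of whose entries outside `Q` vanish. -/
def quiverGroup {n : ℕ} (Q : Finset (Fin n × Fin n)) (hrefl : ∀ i, (i, i) ∈ Q)
    (htrans : ∀ i j k, (i, j) ∈ Q → (j, k) ∈ Q → (i, k) ∈ Q) : Subgroup (GL (Fin n) ℂ) where
  carrier := {B | ∀ i j, (i, j) ∉ Q → (B : Matrix (Fin n) (Fin n) ℂ) i j = 0}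
  one_mem' := by
    intro i j hij
    have : i ≠ j := by
      rintro rfl
      exact hij (hrefl i)
    simp [Matrix.one_apply_ne this]
  mul_mem' := by
    intro B C hB hC i j hij
    rw [Units.val_mul, Matrix.mul_apply]
    refine Finset.sum_eq_zero fun k _ => ?_
    by_cases h : (i, k) ∈ Q
    · rw [hC k j (fun h' => hij (htrans i k j h h')), mul_zero]
    · rw [hB i k h, zero_mul]
  inv_mem' := by
    intro B hB
    let S : Submodule ℂ (Matrix (Fin n) (Fin n) ℂ) :=
      { carrier := {X | ∀ i j, (i, j) ∉ Q → X i j = 0}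
        zero_mem' := fun _ _ _ => rfl
        add_mem' := by
          intro X Y hX hY i j hij
          simp [hX i j hij, hY i j hij]
        smul_mem' := by
          intro c X hX i j hij
          simp [hX i j hij] }
    have hS : ∀ X ∈ S, LinearMap.mulLeft ℂ (B : Matrix (Fin n) (Fin n) ℂ) X ∈ S := by
      intro X hX i j hij
      rw [LinearMap.mulLeft_apply, Matrix.mul_apply]
      refine Finset.sum_eq_zero fun k _ => ?_
      by_cases h : (i, k) ∈ Q
      · rw [hX k j (fun h' => hij (htrans i k j h h')), mul_zero]
      · rw [hB i k h, zero_mul]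
    have hinj : Function.Injective
        ((LinearMap.mulLeft ℂ (B : Matrix (Fin n) (Fin n) ℂ)).restrict hS) := by
      intro X Y hXY
      have h := congrArg Subtype.val hXY
      simp only [LinearMap.coe_restrict_apply, LinearMap.mulLeft_apply] at h
      exact Subtype.ext (B.isUnit.mul_left_cancel h)
    have hone : (1 : Matrix (Fin n) (Fin n) ℂ) ∈ S := by
      intro i j hij
      have : i ≠ j := by
        rintro rfl
        exact hij (hrefl i)
      exact Matrix.one_apply_ne this
    obtain ⟨X, hX⟩ := LinearMap.injective_iff_surjective.mp hinj ⟨1, hone⟩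
    have h : (B : Matrix (Fin n) (Fin n) ℂ) * X = 1 := by
      have := congrArg Subtype.val hX
      simpa only [LinearMap.coe_restrict_apply, LinearMap.mulLeft_apply] using this
    have hval : ((B⁻¹ : GL (Fin n) ℂ) : Matrix (Fin n) (Fin n) ℂ) = X :=
      Units.inv_eq_of_mul_eq_one_right h
    intro i j hij
    rw [hval]
    exact X.2 i j hij

/-- The `m × n` matrix with the coordinates `x`. -/
def toMat {m n : ℕ} (x : Fin m × Fin n → ℂ) : Matrix (Fin m) (Fin n) ℂ :=
  Matrix.of fun i j => x (i, j)

/-- The action `(A, B) · M = A M B⁻¹` of `GL_m(ℂ) × G_R`, for a group `G_R ⊆ GL_n(ℂ)`, on the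
space of `m × n` matrices, in coordinates: the linear map `x ↦ (A, B) · x`. -/
def actLin {m n : ℕ} {R : Subgroup (GL (Fin n) ℂ)} (g : GL (Fin m) ℂ × R) :
    (Fin m × Fin n → ℂ) →ₗ[ℂ] (Fin m × Fin n → ℂ) where
  toFun x := fun q =>
    ((g.1 : Matrix (Fin m) (Fin m) ℂ) * toMat x *
      (((g.2 : GL (Fin n) ℂ)⁻¹ : GL (Fin n) ℂ) : Matrix (Fin n) (Fin n) ℂ)) q.1 q.2
  map_add' x y := by
    have h : toMat (x + y) = toMat x + toMat y := rfl
    funext q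
    rw [h, Matrix.mul_add, Matrix.add_mul]
    rfl
  map_smul' c x := by
    have h : toMat (c • x) = c • toMat x := rfl
    funext q
    rw [h, Matrix.mul_smul, Matrix.smul_mul]
    rfl

/-- The linear representation of `GL_m(ℂ) × G_R` on the space of `m × n` matrices. -/
noncomputable def actHom {m n : ℕ} (R : Subgroup (GL (Fin n) ℂ)) :
    GL (Fin m) ℂ × R →* GL (Fin m × Fin n) ℂ :=
  MonoidHom.toHomUnits
    { toFun := fun g => LinearMap.toMatrix' (actLin g)
      map_one' := by
        have h : actLin (1 : GL (Fin m) ℂ × R) = LinearMap.id := by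
          ext x q
          simp [actLin, toMat]
        rw [h, LinearMap.toMatrix'_id]
      map_mul' := by
        intro g h
        have e : actLin (g * h) = (actLin g) ∘ₗ (actLin h) := by
          refine LinearMap.ext fun x => ?_
          funext q
          have hx : toMat (actLin h x) = (h.1 : Matrix (Fin m) (Fin m) ℂ) * toMat x *
              (((h.2 : GL (Fin n) ℂ)⁻¹ : GL (Fin n) ℂ) : Matrix (Fin n) (Fin n) ℂ) := rfl
          rw [LinearMap.comp_apply]
          change _ = ((g.1 : Matrix (Fin m) (Fin m) ℂ) * toMat (actLin h x) *
            (((g.2 : GL (Fin n) ℂ)⁻¹ : GL (Fin n) ℂ) : Matrix (Fin n) (Fin n) ℂ)) q.1 q.2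
          rw [hx]
          simp only [actLin, LinearMap.coe_mk, AddHom.coe_mk, Prod.fst_mul, Prod.snd_mul,
            Subgroup.coe_mul, _root_.mul_inv_rev, Units.val_mul, Matrix.mul_assoc]
        rw [e, LinearMap.toMatrix'_comp] }

/-- The Lie algebra of `GL_m(ℂ) × G_R` modulo the kernel of its action on the `m × n` matrices,
that is, of the image of this group in the general linear group of the space of matrices. -/
noncomputable def actingLieAlgebra (m : ℕ) {n : ℕ} (R : Subgroup (GL (Fin n) ℂ)) :
    Submodule ℂ (Matrix (Fin m × Fin n) (Fin m × Fin n) ℂ) :=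
  lieAlgebraOf (actHom (m := m) R).range

/-- The divisor of zeros of the `m × m` minor with the columns `σ 0 < σ 1 < ⋯ < σ (m - 1)`. The
strictly increasing maps `σ` correspond to the `m`-element sets of columns, so distinct `σ` are
distinct minors. -/
def minorDivisor {m n : ℕ} (σ : Fin m ↪o Fin n) : Set (Fin m × Fin n → ℂ) :=
  {x | ((toMat x).submatrix id σ).det = 0}

/-- The `m × m` minors whose divisor of zeros is preserved by the action of `GL_m(ℂ) × G_R`. -/
def preservedMinors (m : ℕ) {n : ℕ} (R : Subgroup (GL (Fin n) ℂ)) : Set (Fin m ↪o Fin n) :=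
  {σ | ∀ g : GL (Fin m) ℂ × R, (fun x => actLin g x) '' minorDivisor σ = minorDivisor σ}

/-! ### Zero sets of analytic functions -/

/-! The Lie algebra consists of the fields `M ↦ U M + M V` with `V` supported on `Q`. Only the
multiples of the pair `(1, -1)` give the zero field, so its dimension is `m² + |Q| - 1 = mn`.

The column set of a preserved minor is closed under predecessors in `Q`. The minor is therefore a
semi-invariant: every field of the Lie algebra multiplies it by a constant
(`exists_fderiv_minorDet_eq`). At a smooth point of its divisor all columns of the discriminant
matrix are then tangent to the divisor, so `Δ` vanishes there, and by density on the whole divisor.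
Since a general point of one minor's divisor avoids the other minors (`mem_closure_smooth_minor`),
the product of all preserved minors divides `Δ` (`exists_eq_mul_prod_minorDet`).

Degrees now decide everything: `Δ` is homogeneous of degree `mn`, a product of `k` minors of degree
`mk`. For `k = n` the quotient is a constant; for `k > n` it must vanish
(`exists_det_coeffMatrix_eq`). In the first case freeness is Saito's criterion: replacing one column
of the discriminant matrix by a logarithmic field gives a determinant still divisible by `Δ`, and
Cramer's rule turns the quotients into coefficients (`isLogBasis_of_det_eq`).

The definitions require division over arbitrary open sets, so divisibility by a minor is proved
analytically. Along the direction of the identity in the chosen columns, a minor restricts to a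
characteristic polynomial, generically with simple roots, and a Cauchy integral produces the local
quotient (`exists_local_quotient`). -/

theorem dense_ne_zero_of_analytic {E : Type*} [NormedAddCommGroup E] [NormedSpace ℂ E]
    {F : E → ℂ} (hF : AnalyticOnNhd ℂ F Set.univ) (hne : ∃ x, F x ≠ 0) :
    Dense {x | F x ≠ 0} := by
  obtain ⟨x₀, hx₀⟩ := hne
  rw [← Set.compl_ofPred, ← interior_eq_empty_iff_dense_compl, Set.eq_empty_iff_forall_notMem]
  intro y hy
  refine hx₀ (hF.eqOn_zero_of_preconnected_of_eventuallyEq_zero ?_ (Set.mem_univ y) ?_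
    (Set.mem_univ x₀))
  · have : NormedSpace ℝ E := NormedSpace.restrictScalars ℝ ℂ E
    exact isPreconnected_univ
  · filter_upwards [mem_interior_iff_mem_nhds.mp hy] with z hz using hz

/-- Finitely many analytic functions that are not identically zero on a subspace have no common
zero on a dense subset of it. -/
theorem mem_closure_submodule_forall_ne_zero {E κ : Type*} [NormedAddCommGroup E] [NormedSpace ℂ E]
    [FiniteDimensional ℂ E] (W : Submodule ℂ E) (s : Finset κ) (F : κ → E → ℂ)
    (hF : ∀ k ∈ s, AnalyticOnNhd ℂ (F k) Set.univ) (hne : ∀ k ∈ s, ∃ x ∈ W, F k x ≠ 0)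
    {x : E} (hx : x ∈ W) : x ∈ closure {y | y ∈ W ∧ ∀ k ∈ s, F k y ≠ 0} := by
  have hG : ∀ k ∈ s, AnalyticOnNhd ℂ (fun y : W => F k y) Set.univ := fun k hk y _ =>
    (hF k hk y (Set.mem_univ _)).comp (W.subtypeL.analyticAt y)
  have hd : Dense {y : W | ∀ k ∈ s, F k y ≠ 0} := by
    classical
    -- Openness is carried through the induction because an intersection of two dense sets is dense
    -- only when one of them is open.
    suffices h : ∀ t ⊆ s, Dense {y : W | ∀ k ∈ t, F k y ≠ 0} ∧
        IsOpen {y : W | ∀ k ∈ t, F k y ≠ 0} from (h s subset_rfl).1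
    intro t
    induction t using Finset.induction_on with
    | empty => simp
    | insert k t hk ih =>
      intro ht
      obtain ⟨h1, h2⟩ := ih ((Finset.subset_insert _ _).trans ht)
      have hks : k ∈ s := ht (Finset.mem_insert_self _ _)
      have h3 : Dense {y : W | F k y ≠ 0} := by
        obtain ⟨z, hz, hz'⟩ := hne k hks
        exact dense_ne_zero_of_analytic (hG k hks) ⟨⟨z, hz⟩, hz'⟩
      have h4 : IsOpen {y : W | F k y ≠ 0} :=
        isOpen_ne_fun (continuousOn_univ.mp (hG k hks).continuousOn) continuous_const
      have e : {y : W | ∀ j ∈ insert k t, F j y ≠ 0}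
          = {y : W | F k y ≠ 0} ∩ {y : W | ∀ j ∈ t, F j y ≠ 0} := by
        ext y
        simp
      rw [e]
      exact ⟨h3.inter_of_isOpen_left h1 h4, h4.inter h2⟩
  have := image_closure_subset_closure_image (f := (Subtype.val : W → E)) continuous_subtype_val
    ⟨⟨x, hx⟩, hd.closure_eq ▸ Set.mem_univ _, rfl⟩
  refine closure_mono ?_ this
  rintro _ ⟨y, hy, rfl⟩
  exact ⟨y.2, hy⟩

/-! ### Division of holomorphic functions -/

/-- Averages of a holomorphic function over translates of a circle depend holomorphically on the
translation. -/
theorem exists_differentiableOn_circleIntegral {E : Type*} [NormedAddCommGroup E]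
    [NormedSpace ℂ E] [FiniteDimensional ℂ E] {O : Set E} (hO : IsOpen O) {Φ : E → ℂ}
    (hΦ : DifferentiableOn ℂ Φ O) (p v : E) {r : ℝ} (hr : 0 < r)
    (hsub : ∀ t ∈ Metric.sphere (0 : ℂ) r, p + t • v ∈ O) :
    ∃ δ > 0, DifferentiableOn ℂ
      (fun y => ∮ t in C(0, r), (t - 0)⁻¹ • Φ (y + t • v)) (Metric.ball p δ) := by
  have : ProperSpace E := FiniteDimensional.proper ℂ E
  set K : Set E := (fun t : ℂ => p + t • v) '' Metric.sphere 0 r with hK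
  have hKc : IsCompact K := (isCompact_sphere _ _).image (by fun_prop)
  obtain ⟨δ, hδ, hKδ⟩ := hKc.exists_cthickening_subset_open hO
    (by rintro _ ⟨t, ht, rfl⟩; exact hsub t ht)
  obtain ⟨C, hC⟩ := (hKc.cthickening (r := δ)).exists_bound_of_continuousOn
    (hΦ.continuousOn.mono hKδ)
  -- Half of `δ` is spent on moving the centre, the other half on a ball around each point of the
  -- moved circle, where Cauchy's estimate will be applied.
  have hmem : ∀ y ∈ Metric.ball p (δ / 2), ∀ θ : ℝ, ∀ z ∈ Metric.ball (y + circleMap 0 r θ • v)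
      (δ / 2), z ∈ Metric.cthickening δ K := by
    intro y hy θ z hz
    refine Metric.mem_cthickening_of_dist_le z (p + circleMap 0 r θ • v) δ K
      ⟨_, circleMap_mem_sphere _ hr.le _, rfl⟩ ?_
    have h1 : dist (y + circleMap 0 r θ • v) (p + circleMap 0 r θ • v) < δ / 2 := by
      simpa using hy
    have h2 := dist_triangle z (y + circleMap 0 r θ • v) (p + circleMap 0 r θ • v)
    have h3 := Metric.mem_ball.mp hz
    linarith
  have hmem' : ∀ y ∈ Metric.ball p (δ / 2), ∀ θ : ℝ, y + circleMap 0 r θ • v ∈ O :=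
    fun y hy θ => hKδ (hmem y hy θ _ (Metric.mem_ball_self (by positivity)))
  have hinv : Continuous fun θ : ℝ => (circleMap 0 r θ - 0)⁻¹ :=
    (by fun_prop : Continuous fun θ : ℝ => circleMap 0 r θ - 0).inv₀
      fun θ => by simp [hr.ne']
  have hcont : ∀ y ∈ Metric.ball p (δ / 2), Continuous fun θ : ℝ =>
      deriv (circleMap 0 r) θ • (circleMap 0 r θ - 0)⁻¹ • Φ (y + circleMap 0 r θ • v) := by
    intro y hy
    have h1 : Continuous fun θ : ℝ => Φ (y + circleMap 0 r θ • v) :=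
      hΦ.continuousOn.comp_continuous (by fun_prop) (hmem' y hy)
    exact (by simp only [deriv_circleMap]; fun_prop :
      Continuous fun θ : ℝ => deriv (circleMap 0 r) θ).smul (hinv.smul h1)
  refine ⟨δ / 2, by positivity, fun y hy => ?_⟩
  borelize E
  refine HasFDerivAt.differentiableAt (𝕜 := ℂ) (f' := ∫ θ in (0 : ℝ)..2 * Real.pi,
    (deriv (circleMap 0 r) θ * (circleMap 0 r θ - 0)⁻¹) •
      fderiv ℂ Φ (y + circleMap 0 r θ • v)) ?_ |>.differentiableWithinAt
  refine intervalIntegral.hasFDerivAt_integral_of_dominated_of_fderiv_le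
    (F := fun y θ => deriv (circleMap 0 r) θ • (circleMap 0 r θ - 0)⁻¹ •
      Φ (y + circleMap 0 r θ • v))
    (F' := fun y θ => (deriv (circleMap 0 r) θ * (circleMap 0 r θ - 0)⁻¹) •
      fderiv ℂ Φ (y + circleMap 0 r θ • v))
    (bound := fun _ => (2 * C) / (δ / 2))
    (Metric.isOpen_ball.mem_nhds hy) ?_ ?_ ?_ ?_ ?_ ?_
  · filter_upwards [Metric.isOpen_ball.mem_nhds hy] with z hz
    exact (hcont z hz).aestronglyMeasurable
  · exact (hcont y hy).intervalIntegrable _ _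
  · have h0 : Continuous fun θ : ℝ => deriv (circleMap 0 r) θ * (circleMap 0 r θ - 0)⁻¹ :=
      (by simp only [deriv_circleMap]; fun_prop :
        Continuous fun θ : ℝ => deriv (circleMap 0 r) θ).mul hinv
    have h1 : Measurable fun θ : ℝ => fderiv ℂ Φ (y + circleMap 0 r θ • v) :=
      (measurable_fderiv ℂ Φ).comp (by fun_prop : Continuous _).measurable
    exact h0.aestronglyMeasurable.smul h1.aestronglyMeasurable
  · refine Filter.Eventually.of_forall fun θ _ z hz => ?_
    have h1 : ‖deriv (circleMap 0 r) θ * (circleMap 0 r θ - 0)⁻¹‖ = 1 := by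
      simp [hr.ne', abs_of_pos hr]
    rw [norm_smul, h1, one_mul]
    -- Cauchy's estimate on a ball of radius `δ / 2`: the values differ from the central one by at
    -- most `2 * C`, which explains `bound`.
    refine Complex.norm_fderiv_le_div_of_mapsTo_ball
      (hΦ.mono fun w hw => hKδ (hmem z hz θ w hw)) ?_ (by positivity)
    intro w hw
    have h2 := hC _ (hmem z hz θ w hw)
    have h3 := hC _ (hmem z hz θ _ (Metric.mem_ball_self (by positivity)))
    rw [mem_closedBall_iff_norm]
    linarith [norm_sub_le (Φ w) (Φ (z + circleMap 0 r θ • v))]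
  · exact intervalIntegrable_const
  · refine Filter.Eventually.of_forall fun θ _ z hz => ?_
    have h1 : HasFDerivAt Φ (fderiv ℂ Φ (z + circleMap 0 r θ • v)) (z + circleMap 0 r θ • v) :=
      ((hΦ _ (hmem' z hz θ)).differentiableAt (hO.mem_nhds (hmem' z hz θ))).hasFDerivAt
    have h2 : HasFDerivAt (fun y => Φ (y + circleMap 0 r θ • v))
        (fderiv ℂ Φ (z + circleMap 0 r θ • v)) z := by
      exact h1.comp z ((hasFDerivAt_id z).add_const _)
    have h3 := (h2.const_smul (circleMap 0 r θ - 0)⁻¹).const_smul (deriv (circleMap 0 r) θ)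
    rw [mul_smul]
    exact h3

/-- A holomorphic function of one variable that vanishes at finitely many points is divisible by
the product of the corresponding linear factors. -/
theorem exists_eq_mul_prod_sub {O : Set ℂ} (hO : IsOpen O) {γ : ℂ → ℂ}
    (hγ : DifferentiableOn ℂ γ O) (s : Finset ℂ) (hs : ∀ a ∈ s, a ∈ O → γ a = 0) :
    ∃ h : ℂ → ℂ, DifferentiableOn ℂ h O ∧ ∀ t ∈ O, γ t = h t * ∏ a ∈ s, (t - a) := by
  induction s using Finset.induction_on with
  | empty => exact ⟨γ, hγ, by simp⟩
  | insert a s ha ih =>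
    obtain ⟨h, hd, he⟩ := ih fun b hb => hs b (Finset.mem_insert_of_mem hb)
    by_cases haO : a ∈ O
    · have h0 : h a = 0 := by
        have h1 := he a haO
        rw [hs a (Finset.mem_insert_self _ _) haO] at h1
        refine (mul_eq_zero.mp h1.symm).resolve_right (Finset.prod_ne_zero_iff.mpr ?_)
        intro b hb
        exact sub_ne_zero.mpr (by rintro rfl; exact ha hb)
      refine ⟨dslope h a, (Complex.differentiableOn_dslope (hO.mem_nhds haO)).mpr hd,
        fun t ht => ?_⟩
      rw [Finset.prod_insert ha, he t ht, ← mul_assoc]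
      congr 1
      have := sub_smul_dslope h a t
      rw [h0, sub_zero, smul_eq_mul] at this
      rw [← this, mul_comm]
    · refine ⟨fun t => h t / (t - a), hd.div (by fun_prop) ?_, fun t ht => ?_⟩
      · intro t ht
        exact sub_ne_zero.mpr (by rintro rfl; exact haO ht)
      · have : t - a ≠ 0 := sub_ne_zero.mpr (by rintro rfl; exact haO ht)
        rw [Finset.prod_insert ha, he t ht]
        field_simp

/-- Local division by a function `f` whose restrictions to the lines in some direction are monic
polynomials, generically with simple roots. -/
theorem exists_local_quotient {E : Type*} [NormedAddCommGroup E] [NormedSpace ℂ E]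
    [FiniteDimensional ℂ E] {f g : E → ℂ} {U : Set E} (hU : IsOpen U) (hf : Differentiable ℂ f)
    (hg : DifferentiableOn ℂ g U) (v : E) (P : E → Polynomial ℂ) (hP : ∀ y, (P y).Monic)
    (hfP : ∀ y t, f (y + t • v) = (P y).eval t) (hdense : Dense {y | (P y).roots.Nodup})
    (hvan : ∀ x ∈ U, f x = 0 → g x = 0) {p : E} (hp : p ∈ U) :
    ∃ q : E → ℂ, ∃ δ > 0, DifferentiableOn ℂ q (Metric.ball p δ) ∧
      ∀ y ∈ Metric.ball p δ, g y = q y * f y := by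
  obtain ⟨ρ, hρ, hρU⟩ : ∃ ρ > 0, ∀ t ∈ Metric.closedBall (0 : ℂ) ρ, p + t • v ∈ U := by
    have h1 : ∀ᶠ t : ℂ in nhds 0, p + t • v ∈ U := by
      have : ContinuousAt (fun t : ℂ => p + t • v) 0 := by fun_prop
      exact this.eventually_mem (by simpa using hU.mem_nhds hp)
    obtain ⟨ρ, hρ, h⟩ := Metric.nhds_basis_closedBall.eventually_iff.mp h1
    exact ⟨ρ, hρ, fun t ht => h ht⟩
  -- The restriction of `f` to the line through `p` has finitely many zeros, so some radius avoids
  -- all their moduli.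
  obtain ⟨r, hr0, hrρ, hr⟩ : ∃ r, 0 < r ∧ r ≤ ρ ∧
      ∀ t ∈ Metric.sphere (0 : ℂ) r, f (p + t • v) ≠ 0 := by
    have hfin : ((fun a : ℂ => ‖a‖) '' {a | a ∈ (P p).roots}).Finite :=
      ((P p).roots.toFinset.finite_toSet.subset (by intro a ha; simpa using ha)).image _
    obtain ⟨r, hr, hr'⟩ := (Set.Ioc_infinite hρ).exists_notMem_finite hfin
    refine ⟨r, hr.1, hr.2, fun t ht h => hr' ⟨t, ?_, by simpa using ht⟩⟩
    rw [hfP] at h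
    exact (Polynomial.mem_roots (hP p).ne_zero).mpr h
  have hUo : IsOpen (U ∩ {x | f x ≠ 0}) :=
    hU.inter (isOpen_ne_fun hf.continuous continuous_const)
  have hΦ : DifferentiableOn ℂ (fun x => g x / f x) (U ∩ {x | f x ≠ 0}) := by
    simp only [div_eq_mul_inv]
    exact (hg.mono Set.inter_subset_left).mul (hf.differentiableOn.inv fun x hx => hx.2)
  obtain ⟨δ₁, hδ₁, hq⟩ := exists_differentiableOn_circleIntegral hUo
    (Φ := fun x => g x / f x) hΦ p v hr0
    (fun t ht => ⟨hρU t (Metric.closedBall_subset_closedBall hrρ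
      (Metric.sphere_subset_closedBall ht)), hr t ht⟩)
  have hKc : IsCompact ((fun t : ℂ => p + t • v) '' Metric.closedBall 0 r) :=
    (isCompact_closedBall _ _).image (by fun_prop)
  obtain ⟨δ₂, hδ₂, hK₂⟩ := hKc.exists_cthickening_subset_open hU
    (by rintro _ ⟨t, ht, rfl⟩; exact hρU t (Metric.closedBall_subset_closedBall hrρ ht))
  have hKs : IsCompact ((fun t : ℂ => p + t • v) '' Metric.sphere 0 r) :=
    (isCompact_sphere _ _).image (by fun_prop)
  obtain ⟨δ₃, hδ₃, hK₃⟩ := hKs.exists_cthickening_subset_open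
    (isOpen_ne_fun hf.continuous continuous_const)
    (by rintro _ ⟨t, ht, rfl⟩; exact hr t ht)
  have hshift : ∀ δ' : ℝ, ∀ s : Set ℂ, ∀ y, dist y p < δ' → ∀ t ∈ s,
      y + t • v ∈ Metric.cthickening δ' ((fun t : ℂ => p + t • v) '' s) := by
    intro δ' s y hy t ht
    exact Metric.mem_cthickening_of_dist_le _ (p + t • v) _ _ ⟨t, ht, rfl⟩ (by simpa using hy.le)
  -- If `g / f` extends holomorphically along the line through `y`, Cauchy's formula recovers its
  -- value at `t = 0` from the circle, where `f` does not vanish.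
  set q : E → ℂ := fun y => (2 * Real.pi * Complex.I : ℂ)⁻¹ •
    ∮ t in C(0, r), (t - 0)⁻¹ • (g (y + t • v) / f (y + t • v)) with hqdef
  set δ := min δ₁ (min δ₂ δ₃) with hδ
  have hqd : DifferentiableOn ℂ q (Metric.ball p δ) :=
    (hq.mono (Metric.ball_subset_ball (min_le_left _ _))).const_mul _
  have hbU : Metric.ball p δ ⊆ U := by
    intro y hy
    have h2 : dist y p < δ₂ := (Metric.mem_ball.mp hy).trans_le
      ((min_le_right _ _).trans (min_le_left _ _))
    simpa using hK₂ (hshift δ₂ _ y h2 0 (by simp [hr0.le]))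
  refine ⟨q, δ, by positivity, hqd, fun y hy => ?_⟩
  suffices h : Set.EqOn g (fun y => q y * f y) (Metric.ball p δ) from h hy
  -- For simple roots, vanishing of `g` at the zeros of `f` suffices for divisibility in one
  -- variable. The remaining `y` follow by continuity.
  have hgood : ∀ y ∈ Metric.ball p δ ∩ {y | (P y).roots.Nodup}, g y = q y * f y := by
    rintro y ⟨hy, hnd⟩
    have h2 : dist y p < δ₂ := (Metric.mem_ball.mp hy).trans_le
      ((min_le_right _ _).trans (min_le_left _ _))
    have h3 : dist y p < δ₃ := (Metric.mem_ball.mp hy).trans_le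
      ((min_le_right _ _).trans (min_le_right _ _))
    have hO : IsOpen {t : ℂ | y + t • v ∈ U} := hU.preimage (by fun_prop)
    have hPprod : ∀ t, (P y).eval t = ∏ a ∈ (P y).roots.toFinset, (t - a) := by
      intro t
      conv_lhs => rw [(IsAlgClosed.splits (P y)).eq_prod_roots_of_monic (hP y)]
      rw [Polynomial.eval_multiset_prod, Multiset.map_map, Finset.prod_eq_multiset_prod,
        Multiset.toFinset_val, hnd.dedup]
      simp
    obtain ⟨h, hd, he⟩ := exists_eq_mul_prod_sub hO (γ := fun t => g (y + t • v))
      (hg.comp (by fun_prop) fun t ht => ht) (P y).roots.toFinset (by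
        intro a ha haO
        refine hvan _ haO ?_
        rw [hfP]
        exact (Polynomial.mem_roots (hP y).ne_zero).mp (by simpa using ha))
    have hclosed : Metric.closedBall (0 : ℂ) r ⊆ {t : ℂ | y + t • v ∈ U} :=
      fun t ht => hK₂ (hshift δ₂ _ y h2 t ht)
    have hint : (∮ t in C(0, r), (t - 0)⁻¹ • (g (y + t • v) / f (y + t • v)))
        = ∮ t in C(0, r), (t - 0)⁻¹ • h t := by
      refine circleIntegral.integral_congr hr0.le fun t ht => ?_
      have hne : f (y + t • v) ≠ 0 := hK₃ (hshift δ₃ _ y h3 t ht)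
      have h4 := he t (hclosed (Metric.sphere_subset_closedBall ht))
      rw [← hPprod, ← hfP] at h4
      simp only [h4, mul_div_assoc, div_self hne, mul_one]
    have hq0 : q y = h 0 := by
      rw [hqdef]
      simp only [hint]
      rw [(hd.mono hclosed).circleIntegral_sub_inv_smul (Metric.mem_ball_self hr0), smul_smul,
        inv_mul_cancel₀ (by simp [Real.pi_ne_zero]), one_smul]
    have h5 := he 0 (hclosed (by simp [hr0.le]))
    rw [← hPprod, ← hfP] at h5
    simpa [hq0] using h5
  refine Set.EqOn.of_subset_closure (s := Metric.ball p δ ∩ {y | (P y).roots.Nodup}) hgood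
    (hg.continuousOn.mono hbU) (hqd.continuousOn.mul hf.continuous.continuousOn)
    Set.inter_subset_left ?_
  exact hdense.open_subset_closure_inter Metric.isOpen_ball

/-- Local quotients by a function with dense nonvanishing locus glue. -/
theorem exists_global_quotient {E : Type*} [NormedAddCommGroup E] [NormedSpace ℂ E]
    {f g : E → ℂ} {U : Set E} (hdense : Dense {x | f x ≠ 0})
    (hloc : ∀ p ∈ U, ∃ q : E → ℂ, ∃ δ > 0, DifferentiableOn ℂ q (Metric.ball p δ) ∧
      ∀ y ∈ Metric.ball p δ, g y = q y * f y) :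
    ∃ q : E → ℂ, DifferentiableOn ℂ q U ∧ ∀ x ∈ U, g x = q x * f x := by
  classical
  choose! q δ hδ hd he using hloc
  -- Each point uses its own local quotient. Near `p` this agrees with `q p`, since two local
  -- quotients coincide on the dense set where `f` is nonzero.
  refine ⟨fun x => q x x, fun p hp => ?_, fun x hx => he x hx x (Metric.mem_ball_self (hδ x hx))⟩
  refine DifferentiableWithinAt.congr_of_eventuallyEq (f := q p) ?_ ?_ rfl
  · exact ((hd p hp).differentiableAt
      (Metric.ball_mem_nhds p (hδ p hp))).differentiableWithinAt
  · filter_upwards [self_mem_nhdsWithin,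
      mem_nhdsWithin_of_mem_nhds (Metric.ball_mem_nhds p (hδ p hp))] with y hyU hy
    have hO : IsOpen (Metric.ball y (δ y) ∩ Metric.ball p (δ p)) :=
      Metric.isOpen_ball.inter Metric.isOpen_ball
    have heq : Set.EqOn (q y) (q p) (Metric.ball y (δ y) ∩ Metric.ball p (δ p)) := by
      refine Set.EqOn.of_subset_closure
        (s := (Metric.ball y (δ y) ∩ Metric.ball p (δ p)) ∩ {x | f x ≠ 0}) ?_
        ((hd y hyU).continuousOn.mono Set.inter_subset_left)
        ((hd p hp).continuousOn.mono Set.inter_subset_right) Set.inter_subset_left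
        (hdense.open_subset_closure_inter hO)
      rintro z ⟨⟨hz1, hz2⟩, hz⟩
      exact mul_right_cancel₀ hz ((he y hyU z hz1).symm.trans (he p hp z hz2))
    exact heq ⟨Metric.mem_ball_self (hδ y hyU), hy⟩

/-! ### Maximal minors -/

/-- The `m × m` minor with the columns `σ 0 < ⋯ < σ (m - 1)`, as a function. -/
noncomputable def minorDet {m n : ℕ} (σ : Fin m ↪o Fin n) (x : Fin m × Fin n → ℂ) : ℂ :=
  ((toMat x).submatrix id σ).det

theorem analyticOnNhd_minorDet {m n : ℕ} (σ : Fin m ↪o Fin n) :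
    AnalyticOnNhd ℂ (minorDet σ) Set.univ := by
  have h : minorDet σ = fun x => MvPolynomial.eval x
      (Matrix.of fun i k => MvPolynomial.X (R := ℂ) (i, σ k)).det := by
    funext x
    rw [minorDet, RingHom.map_det]
    congr 1
    ext i k
    simp [toMat]
  rw [h]
  exact AnalyticOnNhd.eval_mvPolynomial _

theorem differentiable_minorDet {m n : ℕ} (σ : Fin m ↪o Fin n) :
    Differentiable ℂ (minorDet σ) := fun x =>
  (analyticOnNhd_minorDet σ x (Set.mem_univ x)).differentiableAt

/-- The `m × n` matrix with the square matrix `N` in the columns `σ` and zeros elsewhere. -/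
noncomputable def spreadCols {m n : ℕ} (σ : Fin m ↪o Fin n) (N : Matrix (Fin m) (Fin m) ℂ) :
    Fin m × Fin n → ℂ :=
  fun q => Function.extend σ (N q.1) 0 q.2

theorem spreadCols_apply {m n : ℕ} (σ : Fin m ↪o Fin n) (N : Matrix (Fin m) (Fin m) ℂ)
    (i k : Fin m) : spreadCols σ N (i, σ k) = N i k :=
  σ.injective.extend_apply _ _ _

theorem spreadCols_of_notMem {m n : ℕ} (σ : Fin m ↪o Fin n) (N : Matrix (Fin m) (Fin m) ℂ)
    (i : Fin m) {j : Fin n} (hj : j ∉ Set.range σ) : spreadCols σ N (i, j) = 0 :=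
  Function.extend_apply' _ _ _ hj

theorem minorDet_add_smul_spreadCols {m n : ℕ} (σ : Fin m ↪o Fin n)
    (y : Fin m × Fin n → ℂ) (t : ℂ) (N : Matrix (Fin m) (Fin m) ℂ) :
    minorDet σ (y + t • spreadCols σ N) = ((toMat y).submatrix id σ + t • N).det := by
  unfold minorDet
  congr 1
  ext i k
  simp [toMat, spreadCols_apply]

theorem minorDet_spreadCols {m n : ℕ} (σ : Fin m ↪o Fin n) (N : Matrix (Fin m) (Fin m) ℂ) :
    minorDet σ (spreadCols σ N) = N.det := by
  unfold minorDet
  congr 1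
  ext i k
  simp [toMat, spreadCols_apply]

theorem dense_minorDet_ne_zero {m n : ℕ} (σ : Fin m ↪o Fin n) :
    Dense {x | minorDet σ x ≠ 0} :=
  dense_ne_zero_of_analytic (analyticOnNhd_minorDet σ)
    ⟨spreadCols σ 1, by simp [minorDet_spreadCols]⟩

/-- Generically the square submatrix in the columns `σ` has distinct eigenvalues. -/
theorem dense_nodup_roots_charpoly {m n : ℕ} (σ : Fin m ↪o Fin n) :
    Dense {y : Fin m × Fin n → ℂ | (-((toMat y).submatrix id σ)).charpoly.roots.Nodup} := by
  let G : Matrix (Fin m) (Fin m) (MvPolynomial (Fin m × Fin n) ℂ) :=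
    -Matrix.of fun i k => MvPolynomial.X (i, σ k)
  have hG : ∀ y : Fin m × Fin n → ℂ, (-((toMat y).submatrix id σ)).charpoly
      = G.charpoly.map (MvPolynomial.eval y) := by
    intro y
    rw [← Matrix.charpoly_map]
    congr 1
    ext i k
    simp [G, toMat]
  -- The resultant depends on the two degrees; specialization at `y` preserves them because the
  -- characteristic polynomial is monic and the characteristic is zero.
  have hres : ∀ y : Fin m × Fin n → ℂ,
      MvPolynomial.eval y (Polynomial.resultant G.charpoly (Polynomial.derivative G.charpoly))
      = Polynomial.resultant (-((toMat y).submatrix id σ)).charpoly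
        (Polynomial.derivative (-((toMat y).submatrix id σ)).charpoly) := by
    intro y
    rw [← Polynomial.resultant_map_map, ← Polynomial.derivative_map, ← hG]
    simp only [Polynomial.natDegree_derivative, Matrix.charpoly_natDegree_eq_dim]
  refine (dense_ne_zero_of_analytic (AnalyticOnNhd.eval_mvPolynomial
    (Polynomial.resultant G.charpoly (Polynomial.derivative G.charpoly))) ?_).mono ?_
  -- The sign cancels the one in `G`, leaving the distinct eigenvalues `0, …, m - 1`.
  · refine ⟨spreadCols σ (-Matrix.diagonal fun i : Fin m => ((i : ℕ) : ℂ)), ?_⟩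
    rw [hres]
    refine Polynomial.resultant_ne_zero _ _ ?_
    have h : -((toMat (spreadCols σ (-Matrix.diagonal fun i : Fin m => ((i : ℕ) : ℂ)))).submatrix id σ)
        = Matrix.diagonal fun i : Fin m => ((i : ℕ) : ℂ) := by
      ext i k
      simp [toMat, spreadCols_apply, -diagonal_neg]
    rw [h, Matrix.charpoly_diagonal]
    refine Polynomial.separable_prod_X_sub_C_iff.mpr fun i k hik => ?_
    exact Fin.ext (by exact_mod_cast hik)
  · intro y hy
    rw [Set.mem_ofPred_eq, hres] at hy
    have hne : (-((toMat y).submatrix id σ)).charpoly ≠ 0 := (Matrix.charpoly_monic _).ne_zero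
    rw [ne_eq, Polynomial.resultant_eq_zero_iff] at hy
    have : (-((toMat y).submatrix id σ)).charpoly.Separable := by
      by_contra h
      exact hy ⟨Or.inl hne, h⟩
    exact Polynomial.nodup_roots this

/-- A holomorphic function that vanishes on the divisor of a maximal minor is divisible by it. -/
theorem exists_eq_mul_minorDet {m n : ℕ} (σ : Fin m ↪o Fin n) {U : Set (Fin m × Fin n → ℂ)}
    (hU : IsOpen U) {g : (Fin m × Fin n → ℂ) → ℂ} (hg : DifferentiableOn ℂ g U)
    (hvan : ∀ x ∈ U, minorDet σ x = 0 → g x = 0) :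
    ∃ q : (Fin m × Fin n → ℂ) → ℂ, DifferentiableOn ℂ q U ∧
      ∀ x ∈ U, g x = q x * minorDet σ x := by
  refine exists_global_quotient (dense_minorDet_ne_zero σ) fun p hp => ?_
  -- With `Y` the submatrix in the columns `σ`, `det (Y + t)` is the characteristic polynomial of
  -- `-Y` at `t`.
  refine exists_local_quotient hU (differentiable_minorDet σ) hg (spreadCols σ 1)
    (fun y => (-((toMat y).submatrix id σ)).charpoly) (fun y => Matrix.charpoly_monic _)
    (fun y t => ?_) (dense_nodup_roots_charpoly σ) hvan hp
  rw [minorDet_add_smul_spreadCols, Matrix.eval_charpoly, sub_neg_eq_add, add_comm]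
  congr 2
  ext i k
  simp [Matrix.scalar_apply, Matrix.diagonal_apply, Matrix.one_apply]

/-- Every point of the divisor of the minor `σ` is a limit of smooth points of this divisor that
do not lie on the divisors of finitely many other minors. -/
theorem mem_closure_smooth_minor {m n : ℕ} (σ : Fin m ↪o Fin n) (s : Finset (Fin m ↪o Fin n))
    (hs : σ ∉ s) {x : Fin m × Fin n → ℂ} (hx : minorDet σ x = 0) :
    x ∈ closure {y | minorDet σ y = 0 ∧ fderiv ℂ (minorDet σ) y ≠ 0 ∧
      ∀ τ ∈ s, minorDet τ y ≠ 0} := by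
  obtain ⟨w, hw0, hw⟩ := Matrix.exists_vecMul_eq_zero_iff.mpr hx
  obtain ⟨a, ha⟩ := Function.ne_iff.mp hw0
  simp only [Pi.zero_apply] at ha
  -- Fixing the left null vector `w` of the submatrix of `x` gives a linear space inside the divisor
  -- and through `x`. On it each required inequality needs only one witness.
  let W : Submodule ℂ (Fin m × Fin n → ℂ) :=
    { carrier := {y | w ᵥ* (toMat y).submatrix id σ = 0}
      zero_mem' := by
        ext k
        simp [toMat, Matrix.vecMul, dotProduct]
      add_mem' := by
        intro y z hy hz
        have : (toMat (y + z)).submatrix id σ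
            = (toMat y).submatrix id σ + (toMat z).submatrix id σ := rfl
        simp only [Set.mem_ofPred_eq] at hy hz ⊢
        rw [this, Matrix.vecMul_add, hy, hz, add_zero]
      smul_mem' := by
        intro c y hy
        have : (toMat (c • y)).submatrix id σ = c • (toMat y).submatrix id σ := rfl
        simp only [Set.mem_ofPred_eq] at hy ⊢
        rw [this, Matrix.vecMul_smul, hy, smul_zero] }
  have hW : ∀ y ∈ W, minorDet σ y = 0 := fun y hy =>
    Matrix.exists_vecMul_eq_zero_iff.mp ⟨w, hw0, hy⟩
  set u : Fin m → ℂ := Pi.single a (w a)⁻¹ with hu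
  have hwu : w ⬝ᵥ u = 1 := by simp [hu, ha]
  set e := spreadCols σ (vecMulVec u w) with he
  let F : Option (Fin m ↪o Fin n) → (Fin m × Fin n → ℂ) → ℂ := fun o =>
    o.elim (fun y => fderiv ℂ (minorDet σ) y e) minorDet
  refine closure_mono ?_ (mem_closure_submodule_forall_ne_zero W (Finset.insertNone s) F
    ?_ ?_ (x := x) hw)
  · rintro y ⟨hy, hF⟩
    refine ⟨hW y hy, fun h0 => ?_, fun τ hτ => hF (some τ) (by simpa using hτ)⟩
    have := hF none (by simp)
    simp [F, h0] at this
  · rintro (_ | τ) -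
    · exact fun y hy => ((ContinuousLinearMap.apply ℂ ℂ e).analyticAt _).comp
        ((analyticOnNhd_minorDet σ).fderiv y hy)
    · exact analyticOnNhd_minorDet τ
  · rintro (_ | τ) hτ
    -- Since `w ⬝ᵥ u = 1`, this lies in `W`. Moving by `t • e` gives the minor `det (1 + (t - 1) u
    -- wᵀ) = t`, so the derivative along `e` is `1`.
    · refine ⟨spreadCols σ (1 - vecMulVec u w), ?_, ?_⟩
      · change w ᵥ* _ = 0
        have : (toMat (spreadCols σ (1 - vecMulVec u w))).submatrix id σ = 1 - vecMulVec u w := by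
          ext i k
          simp [toMat, spreadCols_apply]
        rw [this, Matrix.vecMul_sub, Matrix.vecMul_one, Matrix.vecMul_vecMulVec, hwu, one_smul,
          sub_self]
      · have h1 : HasDerivAt (fun t : ℂ => minorDet σ (spreadCols σ (1 - vecMulVec u w) + t • e))
            (fderiv ℂ (minorDet σ) (spreadCols σ (1 - vecMulVec u w)) e) 0 := by
          have h2 : HasDerivAt (fun t : ℂ => spreadCols σ (1 - vecMulVec u w) + t • e) e 0 := by
            simpa using ((hasDerivAt_id (0 : ℂ)).smul_const e).const_add
              (spreadCols σ (1 - vecMulVec u w))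
          have h3 := (differentiable_minorDet σ
            (spreadCols σ (1 - vecMulVec u w) + (0 : ℂ) • e)).hasFDerivAt
          have h4 := h3.comp_hasDerivAt (0 : ℂ) h2
          rw [zero_smul, add_zero] at h4
          exact h4
        have h2 : (fun t : ℂ => minorDet σ (spreadCols σ (1 - vecMulVec u w) + t • e)) = id := by
          funext t
          have h3 : (toMat (spreadCols σ (1 - vecMulVec u w))).submatrix id σ + t • vecMulVec u w
              = 1 + vecMulVec ((t - 1) • u) w := by
            ext i k
            simp [toMat, spreadCols_apply, vecMulVec_apply]
            ring
          rw [he, minorDet_add_smul_spreadCols, h3, vecMulVec_eq Unit,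
            det_one_add_replicateCol_mul_replicateRow, dotProduct_smul, hwu]
          simp
        rw [h2] at h1
        change fderiv ℂ (minorDet σ) (spreadCols σ (1 - vecMulVec u w)) e ≠ 0
        rw [h1.unique (hasDerivAt_id 0)]
        exact one_ne_zero
    · have hne : τ ≠ σ := by
        rintro rfl
        exact hs (by simpa using hτ)
      obtain ⟨l, hl⟩ : ∃ l, τ l ∉ Set.range σ := by
        by_contra! h
        refine hne (DFunLike.coe_injective (τ.strictMono.range_inj σ.strictMono |>.mp ?_))
        refine Set.eq_of_subset_of_ncard_le (Set.range_subset_iff.mpr h) ?_ (Set.toFinite _)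
        rw [Set.ncard_range_of_injective τ.injective, Set.ncard_range_of_injective σ.injective]
      -- Chosen so that `w ᵥ* K` is supported at `a` and `det K = 1`.
      set K : Matrix (Fin m) (Fin m) ℂ :=
        1 + vecMulVec (Pi.single a 1) (Pi.single a 1 - (w a)⁻¹ • w) with hK
      have hwK : ∀ b ≠ a, (w ᵥ* K) b = 0 := by
        intro b hb
        rw [hK, Matrix.vecMul_add, Matrix.vecMul_one, Matrix.vecMul_vecMulVec]
        simp [hb, ha]
      -- The swap puts the only column of `K` not killed by `w` into `τ l`, which lies outside the
      -- columns `σ`; hence the matrix is in `W`.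
      refine ⟨spreadCols τ (K.submatrix id (Equiv.swap a l)), ?_, ?_⟩
      · change w ᵥ* _ = 0
        ext k
        by_cases hk : σ k ∈ Set.range τ
        · obtain ⟨b, hb⟩ := hk
          have hbl : b ≠ l := by
            rintro rfl
            exact hl ⟨k, hb.symm⟩
          have := hwK (Equiv.swap a l b) (by
            intro h
            exact hbl (by simpa using congrArg (Equiv.swap a l) h))
          simpa [Matrix.vecMul, dotProduct, toMat, ← hb, spreadCols_apply] using this
        · simp [Matrix.vecMul, dotProduct, toMat, spreadCols_of_notMem τ _ _ hk]
      · change minorDet τ _ ≠ 0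
        rw [minorDet_spreadCols, Matrix.det_permute']
        refine mul_ne_zero (by simp) ?_
        rw [hK, vecMulVec_eq Unit, det_one_add_replicateCol_mul_replicateRow]
        simp [ha]

/-- A holomorphic function that vanishes on the divisors of several distinct maximal minors is
divisible by their product. -/
theorem exists_eq_mul_prod_minorDet {m n : ℕ} (s : Finset (Fin m ↪o Fin n))
    {U : Set (Fin m × Fin n → ℂ)} (hU : IsOpen U) {g : (Fin m × Fin n → ℂ) → ℂ}
    (hg : DifferentiableOn ℂ g U) (hvan : ∀ σ ∈ s, ∀ x ∈ U, minorDet σ x = 0 → g x = 0) :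
    ∃ q : (Fin m × Fin n → ℂ) → ℂ, DifferentiableOn ℂ q U ∧
      ∀ x ∈ U, g x = q x * ∏ σ ∈ s, minorDet σ x := by
  induction s using Finset.induction_on with
  | empty => exact ⟨g, hg, by simp⟩
  | insert σ s hσ ih =>
    obtain ⟨h, hd, he⟩ := ih fun τ hτ => hvan τ (Finset.mem_insert_of_mem hτ)
    -- If `h` were nonzero at a point of the divisor of `σ`, it would be nonzero at a nearby point
    -- of that divisor off all minors in `s`, where `g = 0` forces `h = 0`.
    obtain ⟨q, hqd, hq⟩ := exists_eq_mul_minorDet σ hU hd (by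
      intro x hxU hx
      by_contra hne
      have hO : IsOpen (U ∩ {y | h y ≠ 0}) :=
        hd.continuousOn.isOpen_inter_preimage hU isOpen_ne
      obtain ⟨y, ⟨hyU, hy⟩, hy1, -, hy2⟩ := mem_closure_iff.mp
        (mem_closure_smooth_minor σ s hσ hx) _ hO ⟨hxU, hne⟩
      have h1 := he y hyU
      rw [hvan σ (Finset.mem_insert_self _ _) y hyU hy1] at h1
      exact (mul_ne_zero hy (Finset.prod_ne_zero_iff.mpr hy2)) h1.symm)
    refine ⟨q, hqd, fun x hx => ?_⟩
    rw [he x hx, hq x hx, Finset.prod_insert hσ, mul_assoc]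

/-! ### The Lie algebra of the acting group -/

theorem hasDerivAt_eval_mvPolynomial {ι : Type*} [Fintype ι] [DecidableEq ι]
    (p : MvPolynomial ι ℂ) {c : ℂ → ι → ℂ} {c' : ι → ℂ} {t : ℂ}
    (hc : ∀ q, HasDerivAt (fun s => c s q) (c' q) t) :
    HasDerivAt (fun s => MvPolynomial.eval (c s) p)
      (∑ q, MvPolynomial.eval (c t) (MvPolynomial.pderiv q p) * c' q) t := by
  induction p using MvPolynomial.induction_on with
  | C a => simpa using hasDerivAt_const t a
  | add p q hp hq => simpa [add_mul, Finset.sum_add_distrib] using hp.fun_add hq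
  | mul_X p i hp =>
    have h := hp.fun_mul (hc i)
    simp only [map_mul, MvPolynomial.eval_X]
    refine h.congr_deriv ?_
    simp only [Derivation.leibniz, MvPolynomial.pderiv_X, smul_eq_mul, map_add, map_mul,
      MvPolynomial.eval_X, add_mul, Finset.sum_add_distrib, Finset.sum_mul]
    rw [add_comm]
    congr 1
    · rw [Finset.sum_eq_single i]
      · simp
      · intro b _ hb
        simp [hb.symm]
      · simp
    · exact Finset.sum_congr rfl fun q _ => by ring

/-- The matrix of the linear vector field `M ↦ U M + M V` on the space of `m × n` matrices. -/
def biMulMatrix {m n : ℕ} :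
    Matrix (Fin m) (Fin m) ℂ × Matrix (Fin n) (Fin n) ℂ →ₗ[ℂ]
      Matrix (Fin m × Fin n) (Fin m × Fin n) ℂ where
  toFun UV := Matrix.of fun p q =>
    UV.1 p.1 q.1 * (1 : Matrix (Fin n) (Fin n) ℂ) p.2 q.2 +
      (1 : Matrix (Fin m) (Fin m) ℂ) p.1 q.1 * UV.2 q.2 p.2
  map_add' a b := by
    ext p q
    simp only [Prod.fst_add, Prod.snd_add, Matrix.add_apply, Matrix.of_apply]
    ring
  map_smul' c a := by
    ext p q
    simp only [Prod.smul_fst, Prod.smul_snd, Matrix.smul_apply, Matrix.of_apply, smul_eq_mul,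
      RingHom.id_apply]
    ring

theorem biMulMatrix_apply {m n : ℕ} (U : Matrix (Fin m) (Fin m) ℂ) (V : Matrix (Fin n) (Fin n) ℂ)
    (p q : Fin m × Fin n) : biMulMatrix (U, V) p q =
      U p.1 q.1 * (1 : Matrix (Fin n) (Fin n) ℂ) p.2 q.2 +
        (1 : Matrix (Fin m) (Fin m) ℂ) p.1 q.1 * V q.2 p.2 := rfl

theorem biMulMatrix_mulVec {m n : ℕ} (U : Matrix (Fin m) (Fin m) ℂ)
    (V : Matrix (Fin n) (Fin n) ℂ) (x : Fin m × Fin n → ℂ) :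
    biMulMatrix (U, V) *ᵥ x = fun q => (U * toMat x + toMat x * V) q.1 q.2 := by
  funext ⟨i, j⟩
  simp only [Matrix.mulVec, dotProduct, biMulMatrix_apply, Fintype.sum_prod_type, add_mul,
    Finset.sum_add_distrib, Matrix.add_apply, Matrix.mul_apply, toMat, Matrix.of_apply,
    Matrix.one_apply]
  congr 1
  · refine Finset.sum_congr rfl fun k _ => ?_
    simp
  · rw [Finset.sum_comm]
    refine Finset.sum_congr rfl fun k _ => ?_
    simp [mul_comm]

/-- The matrices all of whose entries outside `Q` vanish. -/
def supportedMatrices {n : ℕ} (Q : Finset (Fin n × Fin n)) :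
    Submodule ℂ (Matrix (Fin n) (Fin n) ℂ) where
  carrier := {V | ∀ i j, (i, j) ∉ Q → V i j = 0}
  zero_mem' := fun _ _ _ => rfl
  add_mem' := by
    intro X Y hX hY i j hij
    simp [hX i j hij, hY i j hij]
  smul_mem' := by
    intro c X hX i j hij
    simp [hX i j hij]

theorem finrank_supportedMatrices {n : ℕ} (Q : Finset (Fin n × Fin n)) :
    Module.finrank ℂ (supportedMatrices Q) = Q.card := by
  let e : supportedMatrices Q ≃ₗ[ℂ] (Q → ℂ) :=
    { toFun := fun V q => (V : Matrix (Fin n) (Fin n) ℂ) q.1.1 q.1.2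
      map_add' := fun _ _ => rfl
      map_smul' := fun _ _ => rfl
      invFun := fun f => ⟨Matrix.of fun i j => if h : (i, j) ∈ Q then f ⟨(i, j), h⟩ else 0, by
        intro i j hij
        simp [hij]⟩
      left_inv := by
        intro V
        ext i j
        by_cases h : (i, j) ∈ Q
        · simp [h]
        · simp [h, V.2 i j h]
      right_inv := by
        intro f
        funext q
        simp }
  rw [e.finrank_eq, Module.finrank_fintype_fun_eq_card, Fintype.card_coe]

theorem actHom_apply {m n : ℕ} (R : Subgroup (GL (Fin n) ℂ)) (g : GL (Fin m) ℂ × R)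
    (p q : Fin m × Fin n) :
    (actHom R g : Matrix (Fin m × Fin n) (Fin m × Fin n) ℂ) p q =
      (g.1 : Matrix (Fin m) (Fin m) ℂ) p.1 q.1 *
        (((g.2 : GL (Fin n) ℂ)⁻¹ : GL (Fin n) ℂ) : Matrix (Fin n) (Fin n) ℂ) q.2 p.2 := by
  obtain ⟨i, j⟩ := p
  obtain ⟨k, l⟩ := q
  change LinearMap.toMatrix' (actLin g) (i, j) (k, l) = _
  rw [LinearMap.toMatrix'_apply]
  simp only [actLin, LinearMap.coe_mk, AddHom.coe_mk, Matrix.mul_apply, toMat, Matrix.of_apply]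
  rw [Finset.sum_eq_single l, Finset.sum_eq_single k]
  · simp
  · intro a _ ha
    simp [ha]
  · simp
  · intro b _ hb
    rw [Finset.sum_eq_zero, zero_mul]
    intro a _
    simp [hb]
  · simp

/-- The Lie algebra of the acting group consists of the vector fields `M ↦ U M + M V`, with `V`
supported on `Q`. -/
theorem mem_actingLieAlgebra_iff {m n : ℕ} (hm : 1 ≤ m) (hn : 1 ≤ n)
    (Q : Finset (Fin n × Fin n)) (hrefl : ∀ i, (i, i) ∈ Q)
    (htrans : ∀ i j k, (i, j) ∈ Q → (j, k) ∈ Q → (i, k) ∈ Q)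
    (X : Matrix (Fin m × Fin n) (Fin m × Fin n) ℂ) :
    X ∈ actingLieAlgebra m (quiverGroup Q hrefl htrans) ↔
      ∃ U : Matrix (Fin m) (Fin m) ℂ, ∃ V ∈ supportedMatrices Q, X = biMulMatrix (U, V) := by
  constructor
  · intro hX
    let i₀ : Fin m := ⟨0, hm⟩
    let j₀ : Fin n := ⟨0, hn⟩
    have hzero : ∀ i j k l, (l, j) ∉ Q → X (i, j) (k, l) = 0 := by
      intro i j k l hlj
      have h := hX (MvPolynomial.X ((i, j), (k, l))) (by
        rintro _ ⟨g, rfl⟩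
        rw [MvPolynomial.eval_X]
        change (actHom _ g : Matrix _ _ ℂ) (i, j) (k, l) = 0
        rw [actHom_apply]
        exact mul_eq_zero_of_right _ (((g.2)⁻¹).2 l j hlj))
      simpa [MvPolynomial.pderiv_X, Pi.single_apply, apply_ite (MvPolynomial.eval _)] using h
    -- The matrix of the action is a Kronecker product, so its entries satisfy Segre's quadratic
    -- relations; this is their linearization at the identity.
    have hseg : ∀ i j k l, X (i, j) (k, l) = X (i, j₀) (k, j₀) * (1 : Matrix _ _ ℂ) j l
        + (1 : Matrix _ _ ℂ) i k * X (i₀, j) (i₀, l)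
        - (1 : Matrix _ _ ℂ) i k * (1 : Matrix _ _ ℂ) j l * X (i₀, j₀) (i₀, j₀) := by
      intro i j k l
      have h := hX (MvPolynomial.X ((i, j), (k, l)) * MvPolynomial.X ((i₀, j₀), (i₀, j₀))
          - MvPolynomial.X ((i, j₀), (k, j₀)) * MvPolynomial.X ((i₀, j), (i₀, l))) (by
        rintro _ ⟨g, rfl⟩
        simp only [map_sub, map_mul, MvPolynomial.eval_X, actHom_apply]
        ring)
      simp only [map_sub, Derivation.leibniz, MvPolynomial.pderiv_X, smul_eq_mul, map_add,
        MvPolynomial.eval_X, Pi.single_apply, apply_ite (MvPolynomial.eval _),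
        map_zero, sub_mul, add_mul, Finset.sum_sub_distrib, Finset.sum_add_distrib, mul_ite,
        ite_mul, mul_one, mul_zero, zero_mul, Finset.sum_ite_eq,
        Finset.mem_univ, if_true] at h
      have e1 : (1 : Matrix (Fin m × Fin n) (Fin m × Fin n) ℂ) (i, j) (k, l)
          = (1 : Matrix _ _ ℂ) i k * (1 : Matrix _ _ ℂ) j l := by
        simp only [Matrix.one_apply, Prod.mk.injEq]
        split_ifs <;> simp_all
      have e2 : (1 : Matrix (Fin m × Fin n) (Fin m × Fin n) ℂ) (i, j₀) (k, j₀)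
          = (1 : Matrix _ _ ℂ) i k := by
        simp [Matrix.one_apply]
      have e3 : (1 : Matrix (Fin m × Fin n) (Fin m × Fin n) ℂ) (i₀, j) (i₀, l)
          = (1 : Matrix _ _ ℂ) j l := by
        simp [Matrix.one_apply]
      rw [e1, e2, e3, Matrix.one_apply_eq] at h
      linear_combination h
    -- The scalar `X (i₀, j₀) (i₀, j₀)` occurs in both factors; it is removed from the first.
    refine ⟨Matrix.of fun i k => X (i, j₀) (k, j₀) - (1 : Matrix _ _ ℂ) i k * X (i₀, j₀) (i₀, j₀),
      Matrix.of fun l j => X (i₀, j) (i₀, l), fun l j h => hzero _ _ _ _ h, ?_⟩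
    ext ⟨i, j⟩ ⟨k, l⟩
    rw [hseg, biMulMatrix_apply]
    simp only [Matrix.of_apply]
    ring
  · rintro ⟨U, V, hV, rfl⟩ p hp
    -- The curve `M ↦ (1 + t U) M (1 + t V)` lies in the group for small `t` and has velocity
    -- `biMulMatrix (U, V)` at `0`.
    let c : ℂ → (Fin m × Fin n) × (Fin m × Fin n) → ℂ := fun t q =>
      (1 + t • U) q.1.1 q.2.1 * (1 + t • V) q.2.2 q.1.2
    have hentry : ∀ {k : ℕ} (Y : Matrix (Fin k) (Fin k) ℂ) (a b : Fin k),
        HasDerivAt (fun t : ℂ => (1 + t • Y) a b) (Y a b) 0 := by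
      intro k Y a b
      simpa using ((hasDerivAt_id (0 : ℂ)).mul_const (Y a b)).const_add
        ((1 : Matrix _ _ ℂ) a b)
    have hc : ∀ q, HasDerivAt (fun t => c t q) (biMulMatrix (U, V) q.1 q.2) 0 := by
      intro q
      refine ((hentry U q.1.1 q.2.1).fun_mul (hentry V q.2.2 q.1.2)).congr_deriv ?_
      rw [biMulMatrix_apply]
      simp [Matrix.one_apply, eq_comm]
    have hc0 : c 0 = fun q => (1 : Matrix (Fin m × Fin n) (Fin m × Fin n) ℂ) q.1 q.2 := by
      funext ⟨⟨i, j⟩, ⟨k, l⟩⟩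
      simp only [c, zero_smul, add_zero, Matrix.one_apply, Prod.mk.injEq]
      split_ifs <;> simp_all
    have hd := hasDerivAt_eval_mvPolynomial p hc
    rw [hc0] at hd
    refine hd.unique ((hasDerivAt_const (0 : ℂ) (0 : ℂ)).congr_of_eventuallyEq ?_)
    have hdet : ∀ {k : ℕ} (Y : Matrix (Fin k) (Fin k) ℂ),
        ∀ᶠ t : ℂ in nhds 0, (1 + t • Y).det ≠ 0 := by
      intro k Y
      have : Continuous fun t : ℂ => (1 + t • Y).det := by
        refine Continuous.matrix_det ?_
        fun_prop
      exact this.continuousAt.eventually_ne (by simp)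
    filter_upwards [hdet U, hdet V] with t hU hV'
    let A : GL (Fin m) ℂ := Matrix.GeneralLinearGroup.mkOfDetNeZero _ hU
    let B : GL (Fin n) ℂ := Matrix.GeneralLinearGroup.mkOfDetNeZero _ hV'
    have hB : B ∈ quiverGroup Q hrefl htrans := by
      intro i j hij
      have : i ≠ j := by
        rintro rfl
        exact hij (hrefl i)
      change (1 + t • V) i j = 0
      simp [Matrix.one_apply_ne this, hV i j hij]
    have h := hp (actHom _ (A, (⟨B, hB⟩⁻¹ : quiverGroup Q hrefl htrans))) ⟨_, rfl⟩
    have e : (fun q : (Fin m × Fin n) × (Fin m × Fin n) =>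
        (actHom _ (A, (⟨B, hB⟩⁻¹ : quiverGroup Q hrefl htrans)) :
          Matrix (Fin m × Fin n) (Fin m × Fin n) ℂ) q.1 q.2) = c t := by
      funext q
      rw [actHom_apply]
      simp only [Subgroup.coe_inv, inv_inv]
      rfl
    rw [e] at h
    exact h

/-- Rank-nullity for `(U, V) ↦ (M ↦ U M + M V)`: the kernel is the line through `(1, -1)`, the Lie
algebra of `Z`. -/
theorem finrank_actingLieAlgebra {m n : ℕ} (hm : 1 ≤ m) (hn : 1 ≤ n)
    (Q : Finset (Fin n × Fin n)) (hrefl : ∀ i, (i, i) ∈ Q)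
    (htrans : ∀ i j k, (i, j) ∈ Q → (j, k) ∈ Q → (i, k) ∈ Q) :
    Module.finrank ℂ (actingLieAlgebra m (quiverGroup Q hrefl htrans)) + 1 = m ^ 2 + Q.card := by
  let L : Matrix (Fin m) (Fin m) ℂ × supportedMatrices Q →ₗ[ℂ]
      Matrix (Fin m × Fin n) (Fin m × Fin n) ℂ :=
    biMulMatrix ∘ₗ LinearMap.prodMap LinearMap.id (supportedMatrices Q).subtype
  have hL : ∀ U V, L (U, V) = biMulMatrix (U, (V : Matrix _ _ ℂ)) := fun _ _ => rfl
  have hrange : LinearMap.range L = actingLieAlgebra m (quiverGroup Q hrefl htrans) := by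
    ext X
    rw [mem_actingLieAlgebra_iff hm hn]
    constructor
    · rintro ⟨⟨U, V⟩, rfl⟩
      exact ⟨U, V, V.2, rfl⟩
    · rintro ⟨U, V, hV, rfl⟩
      exact ⟨(U, ⟨V, hV⟩), rfl⟩
  have hone : (1 : Matrix (Fin n) (Fin n) ℂ) ∈ supportedMatrices Q := by
    intro i j hij
    refine Matrix.one_apply_ne ?_
    rintro rfl
    exact hij (hrefl i)
  have hker : Module.finrank ℂ (LinearMap.ker L) = 1 := by
    have hspan : LinearMap.ker L = ℂ ∙ ((1, -⟨1, hone⟩) :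
        Matrix (Fin m) (Fin m) ℂ × supportedMatrices Q) := by
      ext ⟨U, V⟩
      rw [LinearMap.mem_ker, hL, Submodule.mem_span_singleton]
      constructor
      · intro h
        have h' : ∀ i j k l, U i k * (1 : Matrix _ _ ℂ) j l
            + (1 : Matrix _ _ ℂ) i k * (V : Matrix _ _ ℂ) l j = 0 := fun i j k l => by
          simpa [biMulMatrix_apply] using congrFun (congrFun h (i, j)) (k, l)
        let i₀ : Fin m := ⟨0, hm⟩
        let j₀ : Fin n := ⟨0, hn⟩
        have h0 := h' i₀ j₀ i₀ j₀
        rw [Matrix.one_apply_eq, Matrix.one_apply_eq] at h0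
        refine ⟨U i₀ i₀, Prod.ext ?_ (Subtype.ext ?_)⟩
        · ext i k
          have h1 := h' i j₀ k j₀
          rw [Matrix.one_apply_eq] at h1
          simp only [Prod.smul_fst, Matrix.smul_apply, smul_eq_mul]
          linear_combination -h1 + (1 : Matrix _ _ ℂ) i k * h0
        · ext l j
          have h1 := h' i₀ j i₀ l
          rw [Matrix.one_apply_eq] at h1
          have h2 : (1 : Matrix (Fin n) (Fin n) ℂ) l j = (1 : Matrix _ _ ℂ) j l := by
            simp [Matrix.one_apply, eq_comm]
          simp only [Prod.smul_snd, Submodule.coe_smul, Submodule.coe_neg, Matrix.smul_apply,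
            Matrix.neg_apply, smul_eq_mul, h2]
          linear_combination -h1
      · rintro ⟨c, hc⟩
        obtain ⟨rfl, rfl⟩ := Prod.ext_iff.mp hc.symm
        ext p q
        rw [biMulMatrix_apply]
        simp [Matrix.one_apply, eq_comm]
    rw [hspan, finrank_span_singleton]
    intro h
    have := congrFun (congrFun (Prod.ext_iff.mp h).1 ⟨0, hm⟩) ⟨0, hm⟩
    simp at this
  have := LinearMap.finrank_range_add_finrank_ker L
  rw [hker, hrange, Module.finrank_prod, finrank_supportedMatrices, Module.finrank_matrix] at this
  rw [this]
  simp [sq]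

/-! ### Preserved minors -/

theorem mem_minorDivisor {m n : ℕ} (σ : Fin m ↪o Fin n) (x : Fin m × Fin n → ℂ) :
    x ∈ minorDivisor σ ↔ minorDet σ x = 0 := Iff.rfl

/-- The columns of a preserved minor are closed under the predecessors in the quiver. -/
theorem mem_range_of_mem_preservedMinors {m n : ℕ} (Q : Finset (Fin n × Fin n))
    (hrefl : ∀ i, (i, i) ∈ Q) (htrans : ∀ i j k, (i, j) ∈ Q → (j, k) ∈ Q → (i, k) ∈ Q)
    {σ : Fin m ↪o Fin n} (hσ : σ ∈ preservedMinors m (quiverGroup Q hrefl htrans))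
    {i : Fin n} {k : Fin m} (hik : (i, σ k) ∈ Q) : i ∈ Set.range σ := by
  by_contra hi
  have hne : i ≠ σ k := by
    rintro rfl
    exact hi ⟨k, rfl⟩
  set E : Matrix (Fin n) (Fin n) ℂ := Matrix.single i (σ k) 1 with hE
  have hEE : E * E = 0 := Matrix.single_mul_single_of_ne _ _ _ _ hne.symm _
  let B : GL (Fin n) ℂ := ⟨1 - E, 1 + E, by
    rw [sub_mul, mul_add, mul_add, hEE]; simp, by
    rw [add_mul, mul_sub, mul_sub, hEE]; simp⟩
  have hB : B ∈ quiverGroup Q hrefl htrans := by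
    intro a b hab
    change (1 - E) a b = 0
    have h1 : a ≠ b := by
      rintro rfl
      exact hab (hrefl a)
    have h2 : ¬ (i = a ∧ σ k = b) := by
      rintro ⟨rfl, rfl⟩
      exact hab hik
    simp [Matrix.one_apply_ne h1, hE, h2]
  -- The columns `σ` form the identity with column `k` erased, and the missing basis vector sits in
  -- column `i`. Acting by `B` adds column `i` to column `σ k` and takes the minor from `0` to `1`.
  let x : Fin m × Fin n → ℂ := fun q =>
    spreadCols σ (1 - Matrix.single k k 1) q + if q.2 = i then (1 : Matrix _ _ ℂ) q.1 k else 0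
  have hxσ : ∀ a l, x (a, σ l) = (1 - Matrix.single k k 1 : Matrix _ _ ℂ) a l := by
    intro a l
    have : σ l ≠ i := fun h => hi ⟨l, h⟩
    simp [x, spreadCols_apply, this]
  have hxi : ∀ a, x (a, i) = (1 : Matrix _ _ ℂ) a k := by
    intro a
    simp [x, spreadCols_of_notMem σ _ a hi]
  have hx : x ∈ minorDivisor σ := by
    rw [mem_minorDivisor]
    refine Matrix.det_eq_zero_of_row_eq_zero k fun l => ?_
    change x (k, σ l) = 0
    rw [hxσ]
    simp [Matrix.one_apply, Matrix.single_apply]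
  let g : GL (Fin m) ℂ × quiverGroup Q hrefl htrans := (1, ⟨B, hB⟩)
  have hgx : actLin g x ∈ minorDivisor σ := hσ g ▸ ⟨x, hx, rfl⟩
  rw [mem_minorDivisor] at hgx
  have h1 : (toMat (actLin g x)).submatrix id σ = 1 := by
    ext a l
    have h2 : toMat (actLin g x) = toMat x * (1 + E) := by
      have : toMat (actLin g x) = (1 : Matrix (Fin m) (Fin m) ℂ) * toMat x * (1 + E) := rfl
      rw [this, Matrix.one_mul]
    rw [h2, Matrix.mul_add, Matrix.mul_one, Matrix.submatrix_apply, Matrix.add_apply]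
    have h3 : (toMat x * E) (id a) (σ l) = x (a, i) * if k = l then 1 else 0 := by
      rw [Matrix.mul_apply, Finset.sum_eq_single i]
      · simp [hE, Matrix.single_apply, toMat]
      · intro b _ hb
        simp [hE, hb.symm]
      · simp
    rw [h3, hxi]
    change x (a, σ l) + _ = _
    rw [hxσ]
    rcases eq_or_ne k l with rfl | h
    · rcases eq_or_ne a k with rfl | hka
      · simp
      · simp [hka, hka.symm]
    · simp [h]
  rw [minorDet, h1, Matrix.det_one] at hgx
  exact one_ne_zero hgx

theorem differentiable_det_one_add_smul {k : ℕ} (Y : Matrix (Fin k) (Fin k) ℂ) :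
    Differentiable ℂ fun t : ℂ => (1 + t • Y).det := by
  simp only [Matrix.det_apply]
  refine Differentiable.fun_sum fun τ _ => Differentiable.const_smul ?_ _
  refine Differentiable.fun_finsetProd fun i _ => ?_
  simp only [Matrix.add_apply, Matrix.smul_apply]
  fun_prop

/-- A preserved minor is a semi-invariant of the Lie algebra. -/
theorem exists_fderiv_minorDet_eq {m n : ℕ} (hm : 1 ≤ m) (hn : 1 ≤ n) (Q : Finset (Fin n × Fin n))
    (hrefl : ∀ i, (i, i) ∈ Q) (htrans : ∀ i j k, (i, j) ∈ Q → (j, k) ∈ Q → (i, k) ∈ Q)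
    {σ : Fin m ↪o Fin n} (hσ : σ ∈ preservedMinors m (quiverGroup Q hrefl htrans))
    {X : Matrix (Fin m × Fin n) (Fin m × Fin n) ℂ}
    (hX : X ∈ actingLieAlgebra m (quiverGroup Q hrefl htrans)) :
    ∃ c : ℂ, ∀ x, fderiv ℂ (minorDet σ) x (X *ᵥ x) = c * minorDet σ x := by
  obtain ⟨U, V, hV, rfl⟩ := (mem_actingLieAlgebra_iff hm hn Q hrefl htrans X).mp hX
  let φ : ℂ → ℂ := fun t => (1 + t • U).det * (1 + t • V.submatrix σ σ).det
  have hφ : Differentiable ℂ φ :=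
    (differentiable_det_one_add_smul U).mul (differentiable_det_one_add_smul _)
  refine ⟨deriv φ 0, fun x => ?_⟩
  let y : Fin m × Fin n → ℂ := fun q => (U * toMat x * V) q.1 q.2
  let c : ℂ → Fin m × Fin n → ℂ := fun t => x + t • (biMulMatrix (U, V) *ᵥ x) + t ^ 2 • y
  have hc : HasDerivAt c (biMulMatrix (U, V) *ᵥ x) 0 := by
    have h1 := ((hasDerivAt_id (0 : ℂ)).smul_const (biMulMatrix (U, V) *ᵥ x)).const_add x
    have h2 := ((hasDerivAt_id (0 : ℂ)).pow 2).smul_const y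
    exact (h1.add h2).congr_deriv (by simp)
  have hc0 : c 0 = x := by simp [c]
  have hmat : ∀ t, toMat (c t) = (1 + t • U) * toMat x * (1 + t • V) := by
    intro t
    have : toMat (c t) = toMat x + t • (U * toMat x + toMat x * V) + t ^ 2 • (U * toMat x * V) := by
      simp only [c, biMulMatrix_mulVec]
      rfl
    rw [this]
    simp only [Matrix.add_mul, Matrix.mul_add, Matrix.one_mul, Matrix.mul_one, Matrix.smul_mul,
      Matrix.mul_smul, smul_add, smul_smul, sq]
    abel
  have hdet : ∀ t, minorDet σ (c t) = φ t * minorDet σ x := by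
    intro t
    have h1 : (toMat (c t)).submatrix id σ = (1 + t • U) * (toMat x).submatrix id σ *
        (1 + t • V.submatrix σ σ) := by
      rw [hmat]
      ext a l
      rw [Matrix.submatrix_apply, Matrix.mul_apply, Matrix.mul_apply]
      -- Closure under predecessors makes `V b (σ l)` vanish for `b` outside the columns `σ`, so
      -- only these columns contribute and the minor is multiplicative along the curve.
      refine (Finset.sum_of_injOn σ σ.injective.injOn (by simp) ?_ ?_).symm
      · intro b _ hb
        have hb' : b ∉ Set.range σ := by simpa using hb
        have h2 : b ≠ σ l := fun h => hb' ⟨l, h.symm⟩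
        have h3 : V b (σ l) = 0 := hV b (σ l) fun h =>
          hb' (mem_range_of_mem_preservedMinors Q hrefl htrans hσ h)
        simp [Matrix.one_apply_ne h2, h3]
      · intro k _
        congr 1
        simp [Matrix.one_apply]
    rw [minorDet, h1, Matrix.det_mul, Matrix.det_mul, minorDet]
    ring
  have h1 : HasDerivAt (fun t => minorDet σ (c t))
      (fderiv ℂ (minorDet σ) x (biMulMatrix (U, V) *ᵥ x)) 0 := by
    have h := (differentiable_minorDet σ (c 0)).hasFDerivAt.comp_hasDerivAt (0 : ℂ) hc
    rw [hc0] at h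
    exact h
  simp only [hdet] at h1
  exact h1.unique ((hφ 0).hasDerivAt.mul_const _)

/-! ### The discriminant determinant -/

/-- The coefficients of `φ` form a nonzero left null vector of `N`. -/
theorem det_eq_zero_of_forall_col_mem_ker {ι : Type*} [Fintype ι] [DecidableEq ι]
    {φ : (ι → ℂ) →L[ℂ] ℂ} (hφ : φ ≠ 0) {N : Matrix ι ι ℂ}
    (hN : ∀ k, φ (fun i => N i k) = 0) : N.det = 0 := by
  have key : ∀ v, φ v = (fun i => φ (Pi.single i 1)) ⬝ᵥ v := by
    intro v
    conv_lhs => rw [← Finset.univ_sum_single v, map_sum]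
    refine Finset.sum_congr rfl fun i _ => ?_
    have : (Pi.single i (v i) : ι → ℂ) = v i • Pi.single i 1 := by
      rw [← Pi.single_smul, smul_eq_mul, mul_one]
    rw [this, map_smul, smul_eq_mul, mul_comm]
  refine Matrix.exists_vecMul_eq_zero_iff.mp ⟨fun i => φ (Pi.single i 1), fun h => hφ ?_, ?_⟩
  · refine ContinuousLinearMap.ext fun v => ?_
    rw [key, h, zero_dotProduct]
    rfl
  · funext k
    exact (key _).symm.trans (hN k)

/-- A determinant whose columns are tangent to the divisor of a minor at its general smooth points
vanishes on this divisor. -/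
theorem det_eq_zero_of_tangent {m n : ℕ} {σ : Fin m ↪o Fin n} {s : Finset (Fin m ↪o Fin n)}
    (hσ : σ ∉ s) {U : Set (Fin m × Fin n → ℂ)} (hU : IsOpen U)
    {N : (Fin m × Fin n → ℂ) → Matrix (Fin m × Fin n) (Fin m × Fin n) ℂ}
    (hN : ContinuousOn (fun y => (N y).det) U)
    (htan : ∀ y ∈ U, minorDet σ y = 0 → (∀ τ ∈ s, minorDet τ y ≠ 0) →
      ∀ k, fderiv ℂ (minorDet σ) y (fun i => N y i k) = 0)
    {x : Fin m × Fin n → ℂ} (hxU : x ∈ U) (hx : minorDet σ x = 0) : (N x).det = 0 := by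
  by_contra hne
  obtain ⟨y, ⟨hyU, hy⟩, hy1, hy2, hy3⟩ := mem_closure_iff.mp (mem_closure_smooth_minor σ s hσ hx) _
    (hN.isOpen_inter_preimage hU isOpen_ne) ⟨hxU, hne⟩
  exact hy (det_eq_zero_of_forall_col_mem_ker hy2 (htan y hyU hy1 hy3))

theorem differentiableOn_finset_prod {E κ : Type*} [NormedAddCommGroup E] [NormedSpace ℂ E]
    {U : Set E} {u : Finset κ} {g : κ → E → ℂ} (hg : ∀ i ∈ u, DifferentiableOn ℂ (g i) U) :
    DifferentiableOn ℂ (fun x => ∏ i ∈ u, g i x) U := by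
  classical
  exact fun x hx => (HasFDerivWithinAt.finsetProd fun i hi =>
    (hg i hi x hx).hasFDerivWithinAt).differentiableWithinAt

theorem differentiableOn_det {ι E : Type*} [Fintype ι] [DecidableEq ι] [NormedAddCommGroup E]
    [NormedSpace ℂ E] {U : Set E} {N : E → Matrix ι ι ℂ}
    (hN : ∀ i k, DifferentiableOn ℂ (fun y => N y i k) U) :
    DifferentiableOn ℂ (fun y => (N y).det) U := by
  simp only [Matrix.det_apply]
  exact DifferentiableOn.fun_sum fun τ _ =>
    (differentiableOn_finset_prod fun i _ => hN (τ i) i).const_smul (Equiv.Perm.sign τ)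

/-- The matrix whose columns are the values at `x` of the linear vector fields `A k`. -/
def coeffMatrix {ι : Type*} [Fintype ι] (A : ι → Matrix ι ι ℂ) (x : ι → ℂ) : Matrix ι ι ℂ :=
  Matrix.of fun i k => (A k *ᵥ x) i

theorem eval_discriminantDet {ι : Type*} [Fintype ι] [DecidableEq ι]
    {L : Submodule ℂ (Matrix ι ι ℂ)} (A : Module.Basis ι ℂ L) (x : ι → ℂ) :
    MvPolynomial.eval x (discriminantDet A) = (coeffMatrix (fun k => (A k : Matrix ι ι ℂ)) x).det := by
  rw [discriminantDet, RingHom.map_det]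
  congr 1
  ext i k
  simp [coeffMatrix, Matrix.mulVec, dotProduct]

theorem differentiable_mulVec_apply {ι : Type*} [Fintype ι] (B : Matrix ι ι ℂ) (i : ι) :
    Differentiable ℂ fun x : ι → ℂ => (B *ᵥ x) i := by
  simp only [Matrix.mulVec, dotProduct]
  fun_prop

theorem differentiable_det_coeffMatrix {ι : Type*} [Fintype ι] [DecidableEq ι]
    (A : ι → Matrix ι ι ℂ) : Differentiable ℂ fun x => (coeffMatrix A x).det := by
  rw [← differentiableOn_univ]
  exact differentiableOn_det fun i k => (differentiable_mulVec_apply (A k) i).differentiableOn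

theorem minorDet_smul {m n : ℕ} (σ : Fin m ↪o Fin n) (t : ℂ) (x : Fin m × Fin n → ℂ) :
    minorDet σ (t • x) = t ^ m * minorDet σ x := by
  have h : (toMat (t • x)).submatrix id σ = t • (toMat x).submatrix id σ := rfl
  rw [minorDet, h, Matrix.det_smul, Fintype.card_fin, minorDet]

theorem det_coeffMatrix_smul {ι : Type*} [Fintype ι] [DecidableEq ι] (A : ι → Matrix ι ι ℂ)
    (t : ℂ) (x : ι → ℂ) :
    (coeffMatrix A (t • x)).det = t ^ Fintype.card ι * (coeffMatrix A x).det := by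
  have h : coeffMatrix A (t • x) = t • coeffMatrix A x := by
    ext i k
    simp [coeffMatrix, Matrix.mulVec_smul]
  rw [h, Matrix.det_smul]

theorem dense_prod_minorDet_ne_zero {m n : ℕ} (s : Finset (Fin m ↪o Fin n)) :
    Dense {x : Fin m × Fin n → ℂ | ∏ σ ∈ s, minorDet σ x ≠ 0} := by
  intro x
  refine closure_mono ?_ (mem_closure_submodule_forall_ne_zero ⊤ s minorDet
    (fun σ _ => analyticOnNhd_minorDet σ)
    (fun σ _ => ⟨spreadCols σ 1, trivial, by simp [minorDet_spreadCols]⟩) (x := x) trivial)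
  rintro y ⟨-, hy⟩
  exact Finset.prod_ne_zero_iff.mpr hy

/-- A determinant of linear vector fields for which at least `n` minors are semi-invariant is a
multiple of the product of these minors, and zero if there are more than `n` of them. -/
theorem exists_det_coeffMatrix_eq {m n : ℕ} (A : Fin m × Fin n →
      Matrix (Fin m × Fin n) (Fin m × Fin n) ℂ) (s : Finset (Fin m ↪o Fin n)) (hs : n ≤ s.card)
    (hA : ∀ σ ∈ s, ∀ k, ∃ c : ℂ, ∀ x, fderiv ℂ (minorDet σ) x (A k *ᵥ x) = c * minorDet σ x) :
    ∃ c : ℂ, ∀ x, (coeffMatrix A x).det =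
      c * 0 ^ (m * (s.card - n)) * ∏ σ ∈ s, minorDet σ x := by
  obtain ⟨q, hqd, hq⟩ := exists_eq_mul_prod_minorDet s isOpen_univ
    (differentiable_det_coeffMatrix A).differentiableOn (by
      intro σ hσ x hxU hx
      refine det_eq_zero_of_tangent (Finset.notMem_empty σ) isOpen_univ
        (differentiable_det_coeffMatrix A).continuous.continuousOn (fun y _ hy _ k => ?_) hxU hx
      obtain ⟨c, hc⟩ := hA σ hσ k
      have := hc y
      rw [hy, mul_zero] at this
      exact this)
  -- With `0 ^ 0 = 1` the formula covers both cases: no extra factor for exactly `n` minors, a zero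
  -- factor for more when `m` is positive.
  refine ⟨q 0, fun x => ?_⟩
  rw [hq x trivial]
  rcases eq_or_ne (∏ σ ∈ s, minorDet σ x) 0 with h0 | h0
  · rw [h0, mul_zero, mul_zero]
  congr 1
  have hqc : Continuous q := (differentiableOn_univ.mp hqd).continuous
  -- Homogeneity gives this identity for `t ≠ 0`; continuity extends it to `t = 0`, which is the
  -- case used.
  have heq : (fun _ : ℂ => q x) = fun t : ℂ => q (t • x) * t ^ (m * (s.card - n)) := by
    refine Continuous.ext_on (dense_compl_singleton (0 : ℂ)) (by fun_prop) (by fun_prop) ?_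
    intro t ht
    have ht0 : t ≠ 0 := ht
    have h1 := hq (t • x) trivial
    rw [det_coeffMatrix_smul, hq x trivial] at h1
    simp only [minorDet_smul, Finset.prod_mul_distrib, Finset.prod_const, Fintype.card_prod,
      Fintype.card_fin] at h1
    have h2 : (t ^ m) ^ s.card = t ^ (m * n) * t ^ (m * (s.card - n)) := by
      rw [← pow_mul, ← pow_add, ← mul_add, Nat.add_sub_cancel' hs]
    rw [h2] at h1
    have h3 : t ^ (m * n) * (∏ σ ∈ s, minorDet σ x) ≠ 0 := mul_ne_zero (pow_ne_zero _ ht0) h0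
    refine mul_left_cancel₀ h3 ?_
    linear_combination h1
  simpa using congrFun heq 0

/-! ### Saito's criterion -/

theorem differentiable_prod_minorDet {m n : ℕ} (s : Finset (Fin m ↪o Fin n)) :
    Differentiable ℂ fun x => ∏ σ ∈ s, minorDet σ x :=
  differentiableOn_univ.mp (differentiableOn_finset_prod fun σ _ =>
    (differentiable_minorDet σ).differentiableOn)

theorem exists_fderiv_prod_minorDet_eq {m n : ℕ} (s : Finset (Fin m ↪o Fin n))
    {X : Matrix (Fin m × Fin n) (Fin m × Fin n) ℂ}
    (hX : ∀ σ ∈ s, ∃ c : ℂ, ∀ x, fderiv ℂ (minorDet σ) x (X *ᵥ x) = c * minorDet σ x) :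
    ∃ c : ℂ, ∀ x, fderiv ℂ (fun x => ∏ σ ∈ s, minorDet σ x) x (X *ᵥ x) =
      c * ∏ σ ∈ s, minorDet σ x := by
  induction s using Finset.induction_on with
  | empty => exact ⟨0, by simp⟩
  | insert σ s hσ ih =>
    obtain ⟨c, hc⟩ := ih fun τ hτ => hX τ (Finset.mem_insert_of_mem hτ)
    obtain ⟨d, hd⟩ := hX σ (Finset.mem_insert_self _ _)
    refine ⟨c + d, fun x => ?_⟩
    simp only [Finset.prod_insert hσ]
    rw [fderiv_fun_mul (differentiable_minorDet σ x) (differentiable_prod_minorDet s x)]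
    simp only [_root_.add_apply, _root_.smul_apply, smul_eq_mul, hc, hd]
    ring

/-- Serves to pass from matrix positions to the index type `Fin r` in `IsLocallyFreeLog`. -/
theorem IsLogBasis.reindex {ι κ κ' : Type*} [Fintype ι] [Fintype κ] [Fintype κ']
    {f : (ι → ℂ) → ℂ} {U : Set (ι → ℂ)} {δ : κ → (ι → ℂ) → (ι → ℂ)} (h : IsLogBasis f U δ)
    (e : κ' ≃ κ) : IsLogBasis f U (fun k => δ (e k)) := by
  obtain ⟨h1, h2, h3⟩ := h
  refine ⟨fun k => h1 (e k), fun η hη => ?_, fun c hc hsum k x hx => ?_⟩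
  · obtain ⟨c, hc, hsum⟩ := h2 η hη
    refine ⟨fun k => c (e k), fun k => hc (e k), fun x hx => ?_⟩
    rw [hsum x hx]
    exact (e.sum_comp fun k => c k x • δ k x).symm
  · have := h3 (fun k => c (e.symm k)) (fun k => hc _) (fun x hx => by
      rw [← hsum x hx, ← e.sum_comp]
      simp) (e k) x hx
    simpa using this

/-- The product of the minors in `s`, up to a nonzero factor, is a reduced equation. -/
theorem isReducedEquation_prod_minorDet {m n : ℕ} (s : Finset (Fin m ↪o Fin n)) {c : ℂ}
    (hc : c ≠ 0) {f : (Fin m × Fin n → ℂ) → ℂ} (hf : ∀ x, f x = c * ∏ σ ∈ s, minorDet σ x) :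
    IsReducedEquation f (⋃ σ ∈ s, minorDivisor σ) := by
  obtain rfl : f = fun x => c * ∏ σ ∈ s, minorDet σ x := funext hf
  have hD : ∀ x, x ∈ ⋃ σ ∈ s, minorDivisor σ ↔ ∃ σ ∈ s, minorDet σ x = 0 := by
    intro x
    simp [mem_minorDivisor]
  refine ⟨(differentiable_prod_minorDet s).const_mul c, fun h => ?_, ?_, fun U g hU hg hvan => ?_⟩
  · obtain ⟨x, hx⟩ := (dense_prod_minorDet_ne_zero s).nonempty
    obtain ⟨σ, hσ, h0⟩ := (hD x).mp (h ▸ Set.mem_univ x)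
    exact hx (Finset.prod_eq_zero hσ h0)
  · ext x
    rw [hD]
    simp [hc, Finset.prod_eq_zero_iff]
  · obtain ⟨q, hqd, hq⟩ := exists_eq_mul_prod_minorDet s hU hg
      fun σ hσ x hx h0 => hvan x hx ((hD x).mpr ⟨σ, hσ, h0⟩)
    refine ⟨fun x => q x * c⁻¹, hqd.mul_const _, fun x hx => ?_⟩
    rw [hq x hx]
    field_simp

/-- Saito's criterion for products of distinct minors. -/
theorem isLogBasis_of_det_eq {m n : ℕ}
    (A : Fin m × Fin n → Matrix (Fin m × Fin n) (Fin m × Fin n) ℂ)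
    (s : Finset (Fin m ↪o Fin n))
    (hA : ∀ σ ∈ s, ∀ k, ∃ c : ℂ, ∀ x, fderiv ℂ (minorDet σ) x (A k *ᵥ x) = c * minorDet σ x)
    {c : ℂ} (hc : c ≠ 0) (hdet : ∀ x, (coeffMatrix A x).det = c * ∏ σ ∈ s, minorDet σ x)
    {U : Set (Fin m × Fin n → ℂ)} (hU : IsOpen U) :
    IsLogBasis (fun x => (coeffMatrix A x).det) U (fun k x => A k *ᵥ x) := by
  classical
  have hfun : (fun x => (coeffMatrix A x).det) = fun x => c * ∏ σ ∈ s, minorDet σ x :=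
    funext hdet
  have hdense : Dense {x | (coeffMatrix A x).det ≠ 0} := by
    refine (dense_prod_minorDet_ne_zero s).mono fun x hx => ?_
    rw [Set.mem_ofPred_eq, hdet]
    exact mul_ne_zero hc hx
  have hfd : ∀ x v, fderiv ℂ (fun x => (coeffMatrix A x).det) x v
      = c * fderiv ℂ (fun x => ∏ σ ∈ s, minorDet σ x) x v := by
    intro x v
    rw [hfun, fderiv_const_mul (differentiable_prod_minorDet s x)]
    rfl
  have hclosure : U ⊆ closure (U ∩ {x | (coeffMatrix A x).det ≠ 0}) :=
    hdense.open_subset_closure_inter hU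
  have hsum : ∀ (h : Fin m × Fin n → ℂ) x, ∑ k, h k • A k *ᵥ x = coeffMatrix A x *ᵥ h := by
    intro h x
    funext i
    simp [coeffMatrix, Matrix.mulVec, dotProduct, Finset.sum_apply, mul_comm]
  have hAd : ∀ k, Differentiable ℂ fun x => A k *ᵥ x := fun k =>
    differentiable_pi.mpr fun i => differentiable_mulVec_apply (A k) i
  refine ⟨fun k => ⟨(hAd k).differentiableOn, ?_⟩, fun η hη => ?_, fun h hh h0 k x hx => ?_⟩
  · obtain ⟨d, hd⟩ := exists_fderiv_prod_minorDet_eq s fun σ hσ => hA σ hσ k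
    refine ⟨fun _ => d, differentiableOn_const _, fun x _ => ?_⟩
    rw [hfd, hd]
    simp only [hdet]
    ring
  · obtain ⟨hηd, p, -, hp⟩ := hη
    have hN : ∀ k, DifferentiableOn ℂ (fun x => ((coeffMatrix A x).updateCol k (η x)).det) U := by
      intro k
      refine differentiableOn_det fun i j => ?_
      simp only [Matrix.updateCol_apply]
      split_ifs
      · exact differentiableOn_pi.mp hηd i
      · exact (differentiable_mulVec_apply (A j) i).differentiableOn
    -- On the divisor of `σ`, Leibniz's rule leaves only the derivative of `minorDet σ` times the
    -- other minors. These are nonzero at `y`, so `η y` is tangent.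
    have htan : ∀ σ ∈ s, ∀ y ∈ U, minorDet σ y = 0 → (∀ τ ∈ s.erase σ, minorDet τ y ≠ 0) →
        fderiv ℂ (minorDet σ) y (η y) = 0 := by
      intro σ hσ y hyU hy hy'
      have h1 : _ = p y * (coeffMatrix A y).det := hp y hyU
      have h2 : (fun x => ∏ τ ∈ s, minorDet τ x)
          = fun x => minorDet σ x * ∏ τ ∈ s.erase σ, minorDet τ x :=
        funext fun x => (Finset.mul_prod_erase s (fun τ => minorDet τ x) hσ).symm
      rw [hfd, h2, fderiv_fun_mul (differentiable_minorDet σ y)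
        (differentiable_prod_minorDet _ y), hdet, Finset.prod_eq_zero hσ hy] at h1
      simp only [_root_.add_apply, _root_.smul_apply, smul_eq_mul, hy, zero_mul, zero_add,
        mul_zero] at h1
      refine (mul_eq_zero.mp ((mul_eq_zero.mp h1).resolve_left hc)).resolve_left ?_
      exact Finset.prod_ne_zero_iff.mpr hy'
    have hvan : ∀ k, ∀ σ ∈ s, ∀ x ∈ U, minorDet σ x = 0 →
        ((coeffMatrix A x).updateCol k (η x)).det = 0 := by
      intro k σ hσ x hxU hx
      refine det_eq_zero_of_tangent (Finset.notMem_erase σ s) hU (hN k).continuousOn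
        (fun y hyU hy hy' j => ?_) hxU hx
      rcases eq_or_ne j k with rfl | hjk
      · simpa using htan σ hσ y hyU hy hy'
      · obtain ⟨d, hd⟩ := hA σ hσ j
        have h1 := hd y
        rw [hy, mul_zero] at h1
        rw [← h1]
        congr 1
        funext i
        simp [hjk, coeffMatrix]
    choose q hqd hq using fun k => exists_eq_mul_prod_minorDet s hU (hN k) (hvan k)
    have hqd' : ∀ k, DifferentiableOn ℂ (fun x => q k x * c⁻¹) U := fun k => (hqd k).mul_const _
    refine ⟨fun k x => q k x * c⁻¹, hqd', ?_⟩
    refine Set.EqOn.of_subset_closure (s := U ∩ {x | (coeffMatrix A x).det ≠ 0}) ?_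
      hηd.continuousOn ?_ Set.inter_subset_left hclosure
    · rintro x ⟨hxU, hx⟩
      simp only
      rw [hsum]
      -- Cramer's rule: the coefficients of `η` are the determinants with one column replaced,
      -- divided by `Δ`; this division has already been carried out holomorphically.
      have h1 : (coeffMatrix A x).det • (fun k => q k x * c⁻¹)
          = Matrix.cramer (coeffMatrix A x) (η x) := by
        funext k
        rw [Matrix.cramer_apply, hq k x hxU, Pi.smul_apply, smul_eq_mul, hdet]
        field_simp
      have h2 := Matrix.mulVec_cramer (coeffMatrix A x) (η x)
      rw [← h1, Matrix.mulVec_smul] at h2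
      exact (smul_right_injective _ hx h2).symm
    · exact continuousOn_finsetSum _ fun k _ =>
        (hqd' k).continuousOn.smul (hAd k).continuous.continuousOn
  · have h1 : Set.EqOn (h k) (fun _ => 0) U := by
      refine Set.EqOn.of_subset_closure (s := U ∩ {x | (coeffMatrix A x).det ≠ 0}) ?_
        (hh k).continuousOn continuousOn_const Set.inter_subset_left hclosure
      rintro y ⟨hyU, hy⟩
      have h2 := h0 y hyU
      rw [hsum (fun k => h k y)] at h2
      exact congrFun (Matrix.eq_zero_of_mulVec_eq_zero hy h2) k
    exact h1 hx

theorem proposition76 (m n : ℕ) (hm : 1 ≤ m) (hmn : m ≤ n)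
    (Q : Finset (Fin n × Fin n))
    (hcard : (Q.card : ℤ) = (m : ℤ) * n - (m : ℤ) ^ 2 + 1)
    (hrefl : ∀ i, (i, i) ∈ Q)
    (htrans : ∀ i j k, (i, j) ∈ Q → (j, k) ∈ Q → (i, k) ∈ Q) :
    Module.finrank ℂ (actingLieAlgebra m (quiverGroup Q hrefl htrans)) = m * n ∧
    ∀ A : Module.Basis (Fin m × Fin n) ℂ (actingLieAlgebra m (quiverGroup Q hrefl htrans)),
      (discriminantDet A ≠ 0 →
        (preservedMinors m (quiverGroup Q hrefl htrans)).ncard = n →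
          IsLinearFreeDivisor
            (⋃ σ ∈ preservedMinors m (quiverGroup Q hrefl htrans), minorDivisor σ) ∧
          IsReducedEquation (fun x => MvPolynomial.eval x (discriminantDet A))
            (⋃ σ ∈ preservedMinors m (quiverGroup Q hrefl htrans), minorDivisor σ)) ∧
      (n < (preservedMinors m (quiverGroup Q hrefl htrans)).ncard →
        discriminantDet A = 0) := by
  have hn : 1 ≤ n := hm.trans hmn
  refine ⟨?_, fun A => ?_⟩
  · have h := finrank_actingLieAlgebra hm hn Q hrefl htrans
    zify at h ⊢
    linarith
  set P := preservedMinors m (quiverGroup Q hrefl htrans) with hP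
  set s : Finset (Fin m ↪o Fin n) := P.toFinite.toFinset with hs
  have hcardP : P.ncard = s.card := Set.ncard_eq_toFinset_card P P.toFinite
  have hunion : (⋃ σ ∈ P, minorDivisor σ) = ⋃ σ ∈ s, minorDivisor σ := by
    simp [hs]
  let B : Fin m × Fin n → Matrix (Fin m × Fin n) (Fin m × Fin n) ℂ := fun k => A k
  have hB : ∀ σ ∈ s, ∀ k, ∃ c : ℂ, ∀ x,
      fderiv ℂ (minorDet σ) x (B k *ᵥ x) = c * minorDet σ x := fun σ hσ k =>
    exists_fderiv_minorDet_eq hm hn Q hrefl htrans (P.toFinite.mem_toFinset.mp hσ) (A k).2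
  have heval : (fun x => MvPolynomial.eval x (discriminantDet A))
      = fun x => (coeffMatrix B x).det := funext fun x => eval_discriminantDet A x
  have hzero : (∀ x, (coeffMatrix B x).det = 0) → discriminantDet A = 0 := fun h =>
    MvPolynomial.funext fun x => by rw [eval_discriminantDet, map_zero]; exact h x
  constructor
  · intro hne hcardn
    rw [hcardP] at hcardn
    obtain ⟨c, hc⟩ := exists_det_coeffMatrix_eq B s hcardn.ge hB
    simp only [hcardn, Nat.sub_self, mul_zero, pow_zero, mul_one] at hc
    have hc0 : c ≠ 0 := by
      rintro rfl
      exact hne (hzero fun x => by rw [hc, zero_mul])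
    have hred := isReducedEquation_prod_minorDet s hc0 hc
    rw [hunion, heval]
    refine ⟨⟨_, hred, fun p => ?_, B, isLogBasis_of_det_eq B s hB hc0 hc isOpen_univ⟩, hred⟩
    -- The linear fields are a basis over every open set, so one global frame witnesses local
    -- freeness.
    refine ⟨Set.univ, isOpen_univ, trivial, _,
      fun k x => B ((Fintype.equivFin (Fin m × Fin n)).symm k) *ᵥ x, fun V hV _ => ?_⟩
    exact (isLogBasis_of_det_eq B s hB hc0 hc hV).reindex _
  · intro hlt
    rw [hcardP] at hlt
    obtain ⟨c, hc⟩ := exists_det_coeffMatrix_eq B s hlt.le hB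
    refine hzero fun x => ?_
    rw [hc, zero_pow (Nat.mul_ne_zero (by omega) (by omega)), mul_zero, zero_mul]
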